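/- Let $\mathbf k$ be a field, $c\in\mathbf k$, and let $Z$ be a well-ordered set. Let $\mathcal M(Z)$ be the free monoid on $Z$, with the degree lexicographical order $\le_{\rm dlex}$, and let $\mathfrak M(Z)\supseteq\mathcal M(Z)$ be the free operated monoid on $Z$, i.e. the monoid of bracketed words, with operator $u\mapsto\lfloor u\rfloor$; thus $\mathfrak M(Z)$ is the free monoid on the set $Z\sqcup\lfloor\mathfrak M(Z)\rfloor$, and $\mathbf k\mathfrak M(Z)$ is the free unital operated algebra on $Z$. Let $\mathfrak M^\star(Z)$ be the set of bracketed words on $Z\sqcup\{\star\}$ in which $\star$ occurs exactly once; for $q\in\mathfrak M^\star(Z)$ write $q|_u$ for the result of replacing $\star$ by $u$ (extended linearly in $u$). A monomial order on $\mathfrak M(Z)$ is a well-order such that $u<v$ implies $q|_u<q|_v$ for all $q\in\mathfrak M^\star(Z)$. For nonzero $s$, $\bar s$ denotes the leading monomial of $s$. A set $S$ is an (operated) Gröbner–Shirshov (GS) basis if all intersection and inclusion compositions of nonzero elements of $S$, divided by their leading coefficients, are trivial modulo $S$ and the word $w$ of the composition, i.e. are linear combinations of elements $q|_s$ with $0\neq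 s\in S$ and $q|_{\bar s}<w$ (for $\mathbf k\mathcal M(Z)$: with contexts $q=a\star b$, $a,b\in\mathcal M(Z)$). $\langle S\rangle$ denotes the operated ideal generated by $S$, i.e. the smallest two-sided ideal of $\mathbf k\mathfrak M(Z)$ that contains $S$ and is closed under $\lfloor\ \rfloor$, and $\mathrm{Irr}(S)=\mathfrak M(Z)\setminus\{q|_{\bar s}\mid 0\ne s\in S,\ q\in\mathfrak M^\star(Z)\}$. Let $\phi$ be the operated polynomial identity $\phi(z)=\lfloor z\rfloor-cz$ and $S_\phi(Z)=\{\lfloor u\rfloor-cu\mid u\in\mathfrak M(Z)\}$; a $\phi$-algebra is a unital $\mathbf k$-algebra with a linear operator $P$ such that $P(r)=cr$ for all $r$. Let $A=\mathbf k\mathcal M(Z)/I_A$ be a unital algebra and let $G$ be a GS basis of the ideal $I_A$ with respect to $\le_{\rm dlex}$ (in particular $G$ generates $I_A$ as a two-sided ideal). (a) Monomial orders on $\mathfrak M(Z)$ that restrict to $\le_{\rm dlex}$ on $\mathcal M(Z)$ exist. One of them is the following: let the degree of a bracketed word be the number of its letters plus the number of its empty brackets $\lfloor1\rfloor$; compare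 two words first by degree, and, when their degrees are equal, lexicographically by their factors in $Z\sqcup\lfloor\mathfrak M(Z)\rfloor$, where letters are compared as in $Z$, a letter is smaller than a bracket, and $\lfloor u\rfloor<\lfloor v\rfloor$ if and only if $u<v$. (b) For every monomial order on $\mathfrak M(Z)$ that restricts to $\le_{\rm dlex}$ on $\mathcal M(Z)$ (such as the order of Guo, Sit and Zhang), $S_\phi(Z)\cup G$ is an operated GS basis of $\langle S_\phi(Z)\cup I_A\rangle$ in $\mathbf k\mathfrak M(Z)$; that is, it is an operated GS basis and $\langle S_\phi(Z)\cup G\rangle=\langle S_\phi(Z)\cup I_A\rangle$. Moreover $$\mathrm{Irr}(S_\phi(Z)\cup G)=\mathfrak M(Z)\setminus\{q|_{\bar s},\ q|_{\lfloor u\rfloor}\mid 0\ne s\in G,\ q\in\mathfrak M^\star(Z),\ u\in\mathfrak M(Z)\}=\mathcal M(Z)\setminus\{q|_{\bar s}\mid 0\neq s\in G,\ q\in\mathfrak M^\star(Z)\},$$ which is the set of the words of $\mathcal M(Z)$ that are not of the form $a\,\bar s\,b$ with $0\ne s\in G$ and $a,b\in\mathcal M(Z)$. The quotient operated algebra $\mathbf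 k\mathfrak M(Z)/\langle S_\phi(Z)\cup I_A\rangle$, with the map from $A$ induced by $\mathbf k\mathcal M(Z)\subseteq\mathbf k\mathfrak M(Z)$, is the free $\phi$-algebra over the unital algebra $A$ (every unital algebra morphism from $A$ to a $\phi$-algebra extends uniquely to a morphism of operated algebras), and the classes of the words in $\mathrm{Irr}(S_\phi(Z)\cup G)$ form a linear basis of it. -/

import Mathlib

universe u v w

noncomputable section

namespace OpGS

/-! ### Bracketed words: the free operated monoid on a set -/

/-- The indecomposable bracketed words: the letters of `Z` and the brackets `⌊w⌋` of arbitrary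
bracketed words `w` (a word being a finite list of indecomposable words). -/
inductive BAtom (Z : Type u) : Type u
  | letter (z : Z) : BAtom Z
  | bracket (w : List (BAtom Z)) : BAtom Z

/-- The free operated monoid `𝔐(Z)` on `Z`: the free monoid on `Z ⊔ ⌊𝔐(Z)⌋`. Its length function
`FreeMonoid.length` is the breadth. -/
abbrev BWord (Z : Type u) : Type u := FreeMonoid (BAtom Z)

/-- The operator `u ↦ ⌊u⌋` of the operated monoid `𝔐(Z)`. -/
def bracket {Z : Type u} (w : BWord Z) : BWord Z := FreeMonoid.of (BAtom.bracket w.toList)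

/-- The inclusion `𝓜(Z) → 𝔐(Z)` of the ordinary words. -/
def incl (Z : Type u) : FreeMonoid Z →* BWord Z := FreeMonoid.map BAtom.letter

section Eval

variable {X : Type u} {M : Type v} [Monoid M]

mutual
/-- The value of an indecomposable bracketed word in the operated monoid `(M, P)`, the letters
being evaluated by `θ`. -/
def evalAtom (P : M → M) (θ : X → M) : BAtom X → M
  | .letter x => θ x
  | .bracket w => P (evalList P θ w)
/-- The product of the values of the entries of a list of indecomposable words. -/
def evalList (P : M → M) (θ : X → M) : List (BAtom X) → M
  | [] => 1
  | a :: l => evalAtom P θ a * evalList P θ l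
end

/-- The morphism of operated monoids from `𝔐(X)` to `(M, P)` that extends `θ : X → M`. -/
def evalWord (P : M → M) (θ : X → M) : BWord X →* M := FreeMonoid.lift (evalAtom P θ)

end Eval

/-- The elements of `𝔐^⋆(Z)`, the bracketed words on `Z ⊔ {⋆}` in which `⋆` occurs exactly once:
each of them is `⋆`, or `a q b`, or `⌊q⌋` with `q` again in `𝔐^⋆(Z)` and `a, b ∈ 𝔐(Z)`. (An element
may have several such descriptions; only its substitution map below is ever used.) -/
inductive StarWord (Z : Type u) : Type u
  | star : StarWord Z
  | mul (a : BWord Z) (q : StarWord Z) (b : BWord Z) : StarWord Z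
  | bracket (q : StarWord Z) : StarWord Z

/-- `q|_u`: the symbol `⋆` in `q` is replaced by `u`. -/
def StarWord.subst {Z : Type u} : StarWord Z → BWord Z → BWord Z
  | .star, u => u
  | .mul a q b, u => a * q.subst u * b
  | .bracket q, u => OpGS.bracket (q.subst u)

/-! ### Leading monomials, compositions and Gröbner–Shirshov bases

These notions are needed for `k 𝓜(Z)` and for `k 𝔐(Z)`. They are written for a monoid `M` with a
length function `len`, a set `ctx` of context maps `u ↦ q|_u`, and a strict order `lt`. -/

section GS

variable {k : Type v} [Field k] {M : Type u} [Monoid M]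

/-- A monomial order, given by its strict part `lt`. -/
structure IsMonomialOrder (ctx : Set (M → M)) (lt : M → M → Prop) : Prop where
  isWellOrder : IsWellOrder M lt
  mono : ∀ q ∈ ctx, ∀ a b : M, lt a b → lt (q a) (q b)

open Classical in
/-- The leading monomial: the largest monomial that occurs in `f`, and `1` when `f = 0`. -/
def lead (lt : M → M → Prop) (f : MonoidAlgebra k M) : M :=
  if h : ∃ m ∈ f.coeff.support, ∀ n ∈ f.coeff.support, n = m ∨ lt n m then h.choose else 1

/-- `f` divided by its leading coefficient. -/
def monicize (lt : M → M → Prop) (f : MonoidAlgebra k M) : MonoidAlgebra k M :=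
  (f.coeff (lead lt f))⁻¹ • f

/-- `f` is trivial modulo `(S, w)`: it is a linear combination of elements `q|_s` with `s ∈ S` and
`q|_{lead s} < w`. Here `q|_s` is the linear extension of `u ↦ q|_u`. -/
def IsTrivialMod (ctx : Set (M → M)) (lt : M → M → Prop) (S : Set (MonoidAlgebra k M)) (w : M)
    (f : MonoidAlgebra k M) : Prop :=
  f ∈ Submodule.span k {g : MonoidAlgebra k M | ∃ q ∈ ctx, ∃ s ∈ S, s ≠ 0 ∧
    lt (q (lead lt s)) w ∧ g = MonoidAlgebra.mapDomain q s}

/-- `S` is a Gröbner–Shirshov basis: all intersection compositions `f u - v g` and all inclusion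
compositions `f - q|_g` of the monicized nonzero elements of `S` are trivial. -/
def IsGSBasis (ctx : Set (M → M)) (len : M → ℕ) (lt : M → M → Prop)
    (S : Set (MonoidAlgebra k M)) : Prop :=
  ∀ f ∈ S, f ≠ 0 → ∀ g ∈ S, g ≠ 0 →
    (∀ w u v : M, w = lead lt f * u → w = v * lead lt g →
      max (len (lead lt f)) (len (lead lt g)) < len w →
      len w < len (lead lt f) + len (lead lt g) →
      IsTrivialMod ctx lt S w
        (monicize lt f * MonoidAlgebra.single u 1 - MonoidAlgebra.single v 1 * monicize lt g)) ∧
    (∀ w : M, ∀ q ∈ ctx, w = lead lt f → w = q (lead lt g) →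
      IsTrivialMod ctx lt S w (monicize lt f - MonoidAlgebra.mapDomain q (monicize lt g)))

/-- The set of the words `q|_{lead s}` with `s` a nonzero element of `S`. -/
def reducible (ctx : Set (M → M)) (lt : M → M → Prop) (S : Set (MonoidAlgebra k M)) : Set M :=
  {m : M | ∃ q ∈ ctx, ∃ s ∈ S, s ≠ 0 ∧ m = q (lead lt s)}

/-- `Irr(S)`: the words that are not of the form `q|_{lead s}` with `s ∈ S`, `s ≠ 0`. -/
def irr (ctx : Set (M → M)) (lt : M → M → Prop) (S : Set (MonoidAlgebra k M)) : Set M :=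
  (reducible ctx lt S)ᶜ

end GS

/-- The contexts of `𝓜(Z)`: the maps `u ↦ a u b`. -/
def wordCtx (Z : Type u) : Set (FreeMonoid Z → FreeMonoid Z) :=
  {q | ∃ a b : FreeMonoid Z, q = fun x => a * x * b}

/-- The contexts of `𝔐(Z)`: the maps `u ↦ q|_u` with `q ∈ 𝔐^⋆(Z)`. -/
def starCtx (Z : Type u) : Set (BWord Z → BWord Z) := Set.range StarWord.subst

/-- The strict degree lexicographical order on `𝓜(Z)`. -/
def dlex {Z : Type u} [LinearOrder Z] (x y : FreeMonoid Z) : Prop :=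
  List.Shortlex (· < ·) x.toList y.toList

/-! ### An explicit monomial order on `𝔐(Z)`

The degree counts the letters and the empty brackets `⌊1⌋`. Words are compared first by degree, and
words of the same degree lexicographically by their indecomposable factors, where a letter is
smaller than a bracket and brackets are compared by their contents. -/

section Order

variable {Z : Type u}

mutual
/-- Number of letters and of empty brackets in an indecomposable word. -/
def degAtom : BAtom Z → ℕ
  | .letter _ => 1
  | .bracket w => max 1 (degList w)
/-- Number of letters and of empty brackets in a word. -/
def degList : List (BAtom Z) → ℕ
  | [] => 0
  | a :: l => degAtom a + degList l
end

variable [LinearOrder Z]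

mutual
/-- Comparison of indecomposable words. -/
inductive AtomLT : BAtom Z → BAtom Z → Prop
  | letter {a b : Z} : a < b → AtomLT (.letter a) (.letter b)
  | letter_bracket (a : Z) (y : List (BAtom Z)) : AtomLT (.letter a) (.bracket y)
  | bracket {x y : List (BAtom Z)} : ListLT x y → AtomLT (.bracket x) (.bracket y)
/-- Comparison of words: degree first, then lexicographically. -/
inductive ListLT : List (BAtom Z) → List (BAtom Z) → Prop
  | deg {x y : List (BAtom Z)} : degList x < degList y → ListLT x y
  | lex {x y : List (BAtom Z)} : degList x = degList y → LexLT x y → ListLT x y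
/-- Lexicographical comparison. -/
inductive LexLT : List (BAtom Z) → List (BAtom Z) → Prop
  | head {a b : BAtom Z} (x y : List (BAtom Z)) : AtomLT a b → LexLT (a :: x) (b :: y)
  | tail (a : BAtom Z) {x y : List (BAtom Z)} : LexLT x y → LexLT (a :: x) (a :: y)
end

/-- The explicit strict order on `𝔐(Z)`. -/
def bracketLT (x y : BWord Z) : Prop := ListLT x.toList y.toList

end Order

/-! ### Operated algebras and operated polynomial identities -/

section Operated

variable {k : Type v} [Field k]

/-- The operator of the free operated algebra `k 𝔐(Z)`: the linear extension of `u ↦ ⌊u⌋`. -/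
def bracketOp (k : Type v) [Field k] (Z : Type u) :
    MonoidAlgebra k (BWord Z) →ₗ[k] MonoidAlgebra k (BWord Z) where
  toFun := MonoidAlgebra.mapDomain bracket
  map_add' := MonoidAlgebra.mapDomain_add _
  map_smul' _ _ := MonoidAlgebra.mapDomain_smul ..

/-- The inclusion `k 𝓜(Z) → k 𝔐(Z)`. -/
def inclAlg (k : Type v) [Field k] (Z : Type u) :
    MonoidAlgebra k (FreeMonoid Z) →ₐ[k] MonoidAlgebra k (BWord Z) :=
  MonoidAlgebra.mapDomainAlgHom k k (incl Z)

/-- The value in the operated algebra `(B, P)` of elements of `k 𝔐(X)` at the point `θ`. -/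
def evalOPI {X : Type u} {B : Type w} [Ring B] [Algebra k B] (P : B →ₗ[k] B) (θ : X → B) :
    MonoidAlgebra k (BWord X) →ₐ[k] B :=
  MonoidAlgebra.lift k B (BWord X) (evalWord P θ)

/-- `(B, P)` is a `φ`-algebra. -/
def IsOPIAlgebra {X : Type u} (φ : MonoidAlgebra k (BWord X)) {B : Type w} [Ring B] [Algebra k B]
    (P : B →ₗ[k] B) : Prop :=
  ∀ θ : X → B, evalOPI P θ φ = 0

/-- `S_φ(Z)`: the values of `φ` at bracketed words on `Z`. -/
def wordInstances {X : Type w} (φ : MonoidAlgebra k (BWord X)) (Z : Type u) :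
    Set (MonoidAlgebra k (BWord Z)) :=
  {f | ∃ θ : X → BWord Z, f = evalOPI (bracketOp k Z) (fun x => MonoidAlgebra.single (θ x) 1) φ}

/-- The OPI `⌊z⌋ - c z` in one variable `z`. -/
def scalarOPI (c : k) : MonoidAlgebra k (BWord Unit) :=
  MonoidAlgebra.single (bracket (FreeMonoid.of (BAtom.letter ()))) 1 -
    MonoidAlgebra.single (FreeMonoid.of (BAtom.letter ())) c

variable {Z : Type u}

/-- The operated ideal of `k 𝔐(Z)` generated by `S`: the smallest two-sided ideal that contains `S`
and is closed under the operator. -/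
def operatedIdeal (S : Set (MonoidAlgebra k (BWord Z))) :
    TwoSidedIdeal (MonoidAlgebra k (BWord Z)) :=
  sInf {J | S ⊆ (J : Set (MonoidAlgebra k (BWord Z))) ∧ ∀ f ∈ J, bracketOp k Z f ∈ J}

theorem subset_operatedIdeal (S : Set (MonoidAlgebra k (BWord Z))) :
    ∀ f ∈ S, f ∈ operatedIdeal S := by
  intro f hf
  rw [operatedIdeal, TwoSidedIdeal.mem_sInf]
  exact fun J hJ => hJ.1 hf

theorem bracketOp_mem_operatedIdeal (S : Set (MonoidAlgebra k (BWord Z))) :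
    ∀ f ∈ operatedIdeal S, bracketOp k Z f ∈ operatedIdeal S := by
  intro f hf
  rw [operatedIdeal, TwoSidedIdeal.mem_sInf] at hf ⊢
  exact fun J hJ => hJ.2 f (hf J hJ)

/-- The quotient of `k 𝔐(Z)` by the operated ideal generated by `S`. -/
abbrev OpQuot (S : Set (MonoidAlgebra k (BWord Z))) : Type (max u v) :=
  (operatedIdeal S).ringCon.Quotient

/-- The quotient map `η`. -/
def opMk (S : Set (MonoidAlgebra k (BWord Z))) : MonoidAlgebra k (BWord Z) →ₐ[k] OpQuot S :=
  RingCon.mkₐ k (operatedIdeal S).ringCon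

/-- The operator that `k 𝔐(Z)` induces on the quotient. -/
def quotOp (S : Set (MonoidAlgebra k (BWord Z))) : OpQuot S →ₗ[k] OpQuot S where
  toFun := Quotient.lift (fun f => opMk S (bracketOp k Z f)) (by
    intro f g h
    have h1 : f - g ∈ operatedIdeal S := (TwoSidedIdeal.rel_iff _ f g).1 h
    have h2 := bracketOp_mem_operatedIdeal S _ h1
    rw [map_sub] at h2
    exact Quotient.sound ((TwoSidedIdeal.rel_iff _ _ _).2 h2))
  map_add' := by
    rintro ⟨f⟩ ⟨g⟩
    change opMk S (bracketOp k Z (f + g)) = opMk S (bracketOp k Z f) + opMk S (bracketOp k Z g)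
    rw [map_add, map_add]
  map_smul' := by
    rintro a ⟨f⟩
    change opMk S (bracketOp k Z (a • f)) = a • opMk S (bracketOp k Z f)
    rw [map_smul, map_smul]

/-- The set `S_φ(Z) ∪ I` in `k 𝔐(Z)`, for `φ = ⌊z⌋ - c z` and an ideal `I` of `k 𝓜(Z)`. -/
def relations (c : k) (I : TwoSidedIdeal (MonoidAlgebra k (FreeMonoid Z))) :
    Set (MonoidAlgebra k (BWord Z)) :=
  wordInstances (scalarOPI c) Z ∪ inclAlg k Z '' (I : Set (MonoidAlgebra k (FreeMonoid Z)))

/-- The map `k 𝓜(Z) / I → k 𝔐(Z) / ⟨S⟩` induced by `k 𝓜(Z) ⊆ k 𝔐(Z)` when `I ⊆ S`. -/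
def quotIncl (I : TwoSidedIdeal (MonoidAlgebra k (FreeMonoid Z)))
    (S : Set (MonoidAlgebra k (BWord Z))) (h : ∀ f ∈ I, inclAlg k Z f ∈ S) :
    I.ringCon.Quotient →ₐ[k] OpQuot S :=
  RingCon.liftₐ I.ringCon ((opMk S).comp (inclAlg k Z)) (by
    intro f g hfg
    have h1 : f - g ∈ I := (TwoSidedIdeal.rel_iff _ f g).1 hfg
    have h2 := subset_operatedIdeal S _ (h _ h1)
    rw [map_sub] at h2
    exact Quotient.sound ((TwoSidedIdeal.rel_iff _ _ _).2 h2))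

/-- `(B, P)` with the algebra morphism `i : A → B` is the free `φ`-algebra over the unital algebra
`A`: it is a `φ`-algebra, and every unital algebra morphism from `A` to a `φ`-algebra extends
uniquely along `i` to a morphism of operated algebras. -/
def IsFreeOPIAlgebraOver.{a, b, u', v', w'} {k : Type v'} [Field k] {X : Type u'}
    (φ : MonoidAlgebra k (BWord X)) {A : Type a} {B : Type b} [Ring A] [Algebra k A] [Ring B] [Algebra k B] (P : B →ₗ[k] B) (i : A →ₐ[k] B) : Prop :=
  IsOPIAlgebra φ P ∧
    ∀ (C : Type w') [Ring C] [Algebra k C] (P' : C →ₗ[k] C), IsOPIAlgebra φ P' →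
      ∀ f : A →ₐ[k] C, ∃! F : B →ₐ[k] C, (∀ b : B, F (P b) = P' (F b)) ∧ F.comp i = f

end Operated

end OpGS

end

noncomputable section

namespace OpGS

-- The explicit order: trichotomy, well-foundedness, compatibility with contexts.

section ExplicitOrder

variable {Z : Type u}

-- Modulo `⌊u⌋ - c u` the operator is multiplication by `c`, so every bracketed word collapses to a
-- scalar multiple of an ordinary word. Hence the quotient is `A` itself with the operator `c`:
-- `relIncl` is onto because brackets can be removed one at a time (`single_word_mem_range`), and it
-- is injective because evaluation in `A` with the operator `c` kills all relations
-- (`operatedIdeal_relations_le_ker`). Freeness is then immediate, since any algebra morphism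
-- between algebras with operator `c` respects the operators.
--
-- For the Gröbner–Shirshov property, a monomial order forces `u < ⌊u⌋` (`lt_bracket`), so `⌊u⌋ - c
-- u` has leading word `⌊u⌋`, of breadth one. Such a word has no proper overlaps, and it contains
-- another leading word only trivially or under the bracket. In the latter case, with `x = q|_{lead
-- g}`, `g` monic and `h = q|_g - x`, the composition equals `-(⌊h⌋ - c h) - c q|_g`, and all its
-- terms lie below `⌊x⌋` (`isTrivialMod_inclusion_bracketSub`). An ordinary word contains no
-- bracket, so compositions inside `G` are those of `k 𝓜(Z)`, already trivial by hypothesis. The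
-- same observation identifies the irreducible words with those of `G`.
--
-- The linear basis needs only the diamond lemma for `k 𝓜(Z)`: irreducible words form a basis of `A`
-- (`irrBasis`), which is carried over by the isomorphism. The diamond lemma combines an abstract
-- descent along a well-order (`exists_leading_term`, `eq_zero_of_mem_ctxSpan`) with an analysis of
-- the relative positions of two subwords (`isTrivialMod_of_overlap`).
--
-- The explicit order is well-founded by induction on the degree. Within one degree, words are
-- handled through their first factor and then their tail, which has smaller degree.

theorem degAtom_pos (a : BAtom Z) : 0 < degAtom a := by
  cases a <;> simp [degAtom]

theorem degList_append (x y : List (BAtom Z)) : degList (x ++ y) = degList x + degList y := by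
  induction x with
  | nil => simp [degList]
  | cons a x ih => simp [degList, ih, add_assoc]

theorem degList_eq_zero {x : List (BAtom Z)} : degList x = 0 ↔ x = [] := by
  cases x with
  | nil => simp [degList]
  | cons a x => simpa [degList] using fun h => absurd h (degAtom_pos a).ne'

theorem degList_map_letter (x : List Z) : degList (x.map BAtom.letter) = x.length := by
  induction x with
  | nil => simp [degList]
  | cons a x ih => simp [degList, degAtom, ih, add_comm]

variable [LinearOrder Z]

mutual
theorem atomLT_trichotomy : ∀ a b : BAtom Z, AtomLT a b ∨ a = b ∨ AtomLT b a
  | .letter a, .letter b => by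
    rcases lt_trichotomy a b with h | h | h
    · exact Or.inl (.letter h)
    · exact Or.inr (Or.inl (h ▸ rfl))
    · exact Or.inr (Or.inr (.letter h))
  | .letter a, .bracket y => Or.inl (.letter_bracket a y)
  | .bracket x, .letter b => Or.inr (Or.inr (.letter_bracket b x))
  | .bracket x, .bracket y => by
    rcases lt_trichotomy (degList x) (degList y) with h | h | h
    · exact Or.inl (.bracket (.deg h))
    · rcases lexLT_trichotomy x y h with h' | h' | h'
      · exact Or.inl (.bracket (.lex h h'))
      · exact Or.inr (Or.inl (h' ▸ rfl))
      · exact Or.inr (Or.inr (.bracket (.lex h.symm h')))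
    · exact Or.inr (Or.inr (.bracket (.deg h)))
theorem lexLT_trichotomy : ∀ x y : List (BAtom Z), degList x = degList y →
    LexLT x y ∨ x = y ∨ LexLT y x
  | [], y => fun h => Or.inr (Or.inl (degList_eq_zero.1 h.symm).symm)
  | a :: x, [] => fun h => absurd (degList_eq_zero.1 h) (by simp)
  | a :: x, b :: y => fun h => by
    rcases atomLT_trichotomy a b with h' | h' | h'
    · exact Or.inl (.head _ _ h')
    · subst h'
      rcases lexLT_trichotomy x y (by simpa [degList] using h) with h'' | h'' | h''
      · exact Or.inl (.tail _ h'')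
      · exact Or.inr (Or.inl (h'' ▸ rfl))
      · exact Or.inr (Or.inr (.tail _ h''))
    · exact Or.inr (Or.inr (.head _ _ h'))
end

theorem listLT_trichotomy (x y : List (BAtom Z)) : ListLT x y ∨ x = y ∨ ListLT y x := by
  rcases lt_trichotomy (degList x) (degList y) with h | h | h
  · exact Or.inl (.deg h)
  · rcases lexLT_trichotomy x y h with h' | h' | h'
    · exact Or.inl (.lex h h')
    · exact Or.inr (Or.inl h')
    · exact Or.inr (Or.inr (.lex h.symm h'))
  · exact Or.inr (Or.inr (.deg h))

/-- A word is accessible as soon as its first factor and all words of smaller degree are. -/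
theorem acc_listLT_cons {n : ℕ} (hn : ∀ x : List (BAtom Z), degList x < n → Acc ListLT x)
    {a : BAtom Z} (ha : Acc AtomLT a) :
    ∀ t : List (BAtom Z), degList (a :: t) = n → Acc ListLT (a :: t) := by
  induction ha with
  | intro a _ iha =>
    intro t ht
    have htn : degList t < n := by
      have := degAtom_pos a
      simp only [degList] at ht
      omega
    -- Factors have positive degree, so the tail falls under `hn`. Within degree `n` this is a
    -- double induction: on the first factor, then on the tail.
    induction hn t htn with
    | intro t _ iht =>
      refine ⟨_, fun y hy => ?_⟩
      cases hy with
      | deg h => exact hn y (ht ▸ h)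
      | lex h h' =>
        cases h' with
        | head x _ hb => exact iha _ hb x (h.trans ht)
        | @tail _ x _ hx =>
          have hd : degList x = degList t := by simpa [degList] using h
          exact iht x (.lex hd hx) (h.trans ht) (hd ▸ htn)

theorem acc_atomLT_letter [WellFoundedLT Z] (z : Z) : Acc AtomLT (BAtom.letter z) := by
  induction z using WellFoundedLT.induction with
  | ind z ih =>
    refine ⟨_, fun y hy => ?_⟩
    cases hy with
    | letter h => exact ih _ h

theorem acc_atomLT_bracket [WellFoundedLT Z] {x : List (BAtom Z)} (hx : Acc ListLT x) :
    Acc AtomLT (BAtom.bracket x) := by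
  induction hx with
  | intro x _ ih =>
    refine ⟨_, fun y hy => ?_⟩
    cases hy with
    | letter_bracket a => exact acc_atomLT_letter a
    | bracket h => exact ih _ h

mutual
-- Nested brackets do not raise the degree, so one degree contains words of every depth. The
-- recursion therefore runs on the structure of the word, with the degree bound only carried along.
theorem acc_atomLT_of_degree_le [WellFoundedLT Z] {n : ℕ}
    (hn : ∀ x : List (BAtom Z), degList x < n → Acc ListLT x) :
    ∀ a : BAtom Z, degAtom a ≤ n → Acc AtomLT a
  | .letter z => fun _ => acc_atomLT_letter z
  | .bracket x => fun h => acc_atomLT_bracket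
      (acc_listLT_of_degree_le hn x ((le_max_right _ _).trans (by simpa [degAtom] using h)))
theorem acc_listLT_of_degree_le [WellFoundedLT Z] {n : ℕ}
    (hn : ∀ x : List (BAtom Z), degList x < n → Acc ListLT x) :
    ∀ x : List (BAtom Z), degList x ≤ n → Acc ListLT x
  | [] => fun _ => by
    refine ⟨_, fun y hy => ?_⟩
    cases hy with
    | deg h => simp [degList] at h
    | lex _ h => cases h
  | a :: t => fun h => h.lt_or_eq.elim (hn _) fun h' =>
      acc_listLT_cons hn
        (acc_atomLT_of_degree_le hn a ((Nat.le_add_right _ _).trans h)) t h'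
end

theorem wellFounded_listLT [WellFoundedLT Z] :
    WellFounded (ListLT : List (BAtom Z) → List (BAtom Z) → Prop) := by
  have key : ∀ n : ℕ, ∀ x : List (BAtom Z), degList x < n → Acc ListLT x := by
    intro n
    induction n with
    | zero => intro x hx; omega
    | succ n ih => exact fun x hx => acc_listLT_of_degree_le ih x (by omega)
  exact ⟨fun x => key _ x (Nat.lt_succ_self _)⟩

instance isWellOrder_bracketLT [WellFoundedLT Z] : IsWellOrder (BWord Z) bracketLT where
  wf := InvImage.wf FreeMonoid.toList wellFounded_listLT
  trichotomous x y hxy hyx := by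
    rcases listLT_trichotomy x.toList y.toList with h | h | h
    · exact absurd h hxy
    · exact FreeMonoid.toList.injective h
    · exact absurd h hyx

theorem LexLT.append_left {x y : List (BAtom Z)} (h : LexLT x y) (a : List (BAtom Z)) :
    LexLT (a ++ x) (a ++ y) := by
  induction a with
  | nil => exact h
  | cons b a ih => exact .tail b ih

theorem LexLT.append_right {x y : List (BAtom Z)} (h : LexLT x y) (b : List (BAtom Z)) :
    LexLT (x ++ b) (y ++ b) := by
  induction x generalizing y with
  | nil => cases h
  | cons c x ih =>
    cases h with
    | head _ _ h => exact .head _ _ h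
    | tail _ h => exact .tail _ (ih h)

theorem ListLT.append_append {x y : List (BAtom Z)} (h : ListLT x y) (a b : List (BAtom Z)) :
    ListLT (a ++ x ++ b) (a ++ y ++ b) := by
  cases h with
  | deg h => exact .deg (by simpa [degList_append] using h)
  | lex h h' =>
    exact .lex (by simpa [degList_append] using h) ((h'.append_left a).append_right b)

theorem ListLT.bracket {x y : List (BAtom Z)} (h : ListLT x y) :
    ListLT [BAtom.bracket x] [BAtom.bracket y] := by
  have hd : degList x ≤ degList y := by
    cases h with
    | deg h => exact h.le
    | lex h _ => exact h.le
  -- The `max 1` can merge the degrees 0 and 1. Whenever the two brackets have equal degree, the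
  -- comparison of their contents decides.
  rcases (max_le_max_left 1 hd).lt_or_eq with h' | h'
  · exact .deg (by simpa [degList, degAtom] using h')
  · exact .lex (by simpa [degList, degAtom] using h') (.head _ _ (.bracket h))

theorem bracketLT_subst {x y : BWord Z} (h : bracketLT x y) (q : StarWord Z) :
    bracketLT (q.subst x) (q.subst y) := by
  induction q with
  | star => exact h
  | mul a q b ih => exact ListLT.append_append ih a.toList b.toList
  | bracket q ih => exact ListLT.bracket ih

theorem isMonomialOrder_bracketLT [WellFoundedLT Z] :
    IsMonomialOrder (starCtx Z) (bracketLT (Z := Z)) where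
  isWellOrder := isWellOrder_bracketLT
  mono := by
    rintro _ ⟨q, rfl⟩ a b h
    exact bracketLT_subst h q

theorem lexLT_map_letter {x y : List Z} (h : x.length = y.length) :
    LexLT (x.map BAtom.letter) (y.map BAtom.letter) ↔ List.Lex (· < ·) x y := by
  induction x generalizing y with
  | nil =>
    obtain rfl : y = [] := List.length_eq_zero_iff.1 h.symm
    exact ⟨nofun, nofun⟩
  | cons a x ih =>
    cases y with
    | nil => simp at h
    | cons b y =>
      have h' : x.length = y.length := by simpa using h
      constructor
      · intro H
        cases H with
        | head _ _ H => cases H with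
          | letter H => exact .rel H
        | tail _ H => exact .cons ((ih h').1 H)
      · intro H
        cases H with
        | rel H => exact .head _ _ (.letter H)
        | cons H => exact .tail _ ((ih h').2 H)

theorem bracketLT_incl_iff (x y : FreeMonoid Z) :
    bracketLT (incl Z x) (incl Z y) ↔ dlex x y := by
  change ListLT (x.toList.map BAtom.letter) (y.toList.map BAtom.letter) ↔ _
  rw [dlex, List.shortlex_def]
  constructor
  · intro h
    cases h with
    | deg h => exact Or.inl (by simpa [degList_map_letter] using h)
    | lex h h' =>
      have h1 : x.toList.length = y.toList.length := by simpa [degList_map_letter] using h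
      exact Or.inr ⟨h1, (lexLT_map_letter h1).1 h'⟩
  · rintro (h | ⟨h, h'⟩)
    · exact .deg (by simpa [degList_map_letter] using h)
    · exact .lex (by simpa [degList_map_letter] using h) ((lexLT_map_letter h).2 h')

end ExplicitOrder

-- Leading monomials and spaces of elements supported below a word.

section LeadingMonomials

variable {k : Type v} [Field k] {M : Type u}

/-- `mapDomain` as a linear map. -/
def mapLin (k : Type v) [Field k] {N : Type w} (q : M → N) :
    MonoidAlgebra k M →ₗ[k] MonoidAlgebra k N where
  toFun := MonoidAlgebra.mapDomain q
  map_add' := MonoidAlgebra.mapDomain_add _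
  map_smul' _ _ := MonoidAlgebra.mapDomain_smul ..

theorem mapLin_apply {N : Type w} (q : M → N) (f : MonoidAlgebra k M) :
    mapLin k q f = MonoidAlgebra.mapDomain q f := rfl

theorem mapDomain_mapDomain {N : Type w} {L : Type*} (p : N → L) (q : M → N)
    (f : MonoidAlgebra k M) :
    MonoidAlgebra.mapDomain p (MonoidAlgebra.mapDomain q f) =
      MonoidAlgebra.mapDomain (p ∘ q) f := by
  ext
  simp [Finsupp.mapDomain_comp]

theorem linearMap_mem_of_single_mem {V : Type*} [AddCommGroup V] [Module k V]
    (L : MonoidAlgebra k M →ₗ[k] V) (N : Submodule k V) {f : MonoidAlgebra k M}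
    (h : ∀ n ∈ f.coeff.support, L (MonoidAlgebra.single n 1) ∈ N) : L f ∈ N := by
  rw [← MonoidAlgebra.sum_coeff_single f, Finsupp.sum, map_sum]
  refine N.sum_mem fun n hn => ?_
  have h1 : (MonoidAlgebra.single n (f.coeff n) : MonoidAlgebra k M) =
      f.coeff n • MonoidAlgebra.single n 1 := by simp
  rw [h1, map_smul]
  exact N.smul_mem _ (h n hn)

/-- The elements all of whose monomials are smaller than `w`. -/
def below (k : Type v) [Field k] (lt : M → M → Prop) (w : M) :
    Submodule k (MonoidAlgebra k M) where
  carrier := {f | ∀ n, f.coeff n ≠ 0 → lt n w}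
  zero_mem' := fun n h => absurd rfl h
  add_mem' := by
    intro f g hf hg n hn
    by_cases h : f.coeff n = 0
    · refine hg n fun h' => hn ?_
      simp [h, h']
    · exact hf n h
  smul_mem' := by
    intro a f hf n hn
    exact hf n fun h => hn (by simp [h])

/-- The form in which lower-order terms are discarded: by linearity only monomials below `w` have to
be checked. -/
theorem linearMap_mem_of_below {V : Type*} [AddCommGroup V] [Module k V] {lt : M → M → Prop}
    {w : M} (L : MonoidAlgebra k M →ₗ[k] V) (N : Submodule k V)
    (h : ∀ n, lt n w → L (MonoidAlgebra.single n 1) ∈ N) {f : MonoidAlgebra k M}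
    (hf : f ∈ below k lt w) : L f ∈ N :=
  linearMap_mem_of_single_mem L N fun n hn => h n (hf n (Finsupp.mem_support_iff.1 hn))

theorem single_mem_below {lt : M → M → Prop} {n w : M} (h : lt n w) (a : k) :
    MonoidAlgebra.single n a ∈ below k lt w := by
  classical
  intro m hm
  rw [MonoidAlgebra.coeff_single, Finsupp.single_apply] at hm
  split_ifs at hm with h'
  · exact h' ▸ h
  · exact absurd rfl hm

theorem below_mono {lt : M → M → Prop} [IsTrans M lt] {w w' : M} (h : lt w w') :
    below k lt w ≤ below k lt w' :=
  fun _ hf n hn => _root_.trans (hf n hn) h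

theorem coeff_eq_zero_of_mem_below {lt : M → M → Prop} [Std.Irrefl lt] {w : M}
    {f : MonoidAlgebra k M} (hf : f ∈ below k lt w) : f.coeff w = 0 := by
  by_contra h
  exact irrefl w (hf w h)

theorem map_mem_below {N : Type w} {lt : M → M → Prop} {lt' : N → N → Prop} {w : M} {q : M → N}
    (hq : ∀ n, lt n w → lt' (q n) (q w)) {f : MonoidAlgebra k M} (hf : f ∈ below k lt w) :
    MonoidAlgebra.mapDomain q f ∈ below k lt' (q w) := by
  refine linearMap_mem_of_below (mapLin k q) _ (fun n hn => ?_) hf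
  rw [mapLin_apply, MonoidAlgebra.mapDomain_single]
  exact single_mem_below (hq n hn) 1

variable [Monoid M] {lt : M → M → Prop} [IsWellOrder M lt]

theorem lead_spec {f : MonoidAlgebra k M} (hf : f ≠ 0) :
    lead lt f ∈ f.coeff.support ∧ ∀ n ∈ f.coeff.support, n = lead lt f ∨ lt n (lead lt f) := by
  have h : ∃ m ∈ f.coeff.support, ∀ n ∈ f.coeff.support, n = m ∨ lt n m := by
    have hne : f.coeff.support.Nonempty := by
      rw [Finsupp.support_nonempty_iff]
      exact fun h => hf (MonoidAlgebra.coeff_eq_zero.1 h)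
    classical
    let _ := linearOrderOfSTO lt
    obtain ⟨m, hm, hmax⟩ := f.coeff.support.exists_max_image id hne
    exact ⟨m, hm, fun n hn => hmax n hn⟩
  rw [lead, dif_pos h]
  exact h.choose_spec

theorem coeff_lead_ne_zero {f : MonoidAlgebra k M} (hf : f ≠ 0) : f.coeff (lead lt f) ≠ 0 :=
  Finsupp.mem_support_iff.1 (lead_spec hf).1

theorem lead_eq {f : MonoidAlgebra k M} {m : M} (hm : f.coeff m ≠ 0)
    (h : ∀ n, f.coeff n ≠ 0 → n = m ∨ lt n m) : lead lt f = m := by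
  have hf : f ≠ 0 := by
    rintro rfl
    exact hm rfl
  obtain ⟨h1, h2⟩ := lead_spec (lt := lt) hf
  rcases h _ (Finsupp.mem_support_iff.1 h1) with h3 | h3
  · exact h3
  · rcases h2 m (Finsupp.mem_support_iff.2 hm) with h4 | h4
    · exact h4.symm
    · exact absurd h4 (asymm h3)

theorem monicize_sub_mem_below {f : MonoidAlgebra k M} (hf : f ≠ 0) :
    monicize lt f - MonoidAlgebra.single (lead lt f) 1 ∈ below k lt (lead lt f) := by
  classical
  intro n hn
  simp only [monicize, MonoidAlgebra.coeff_sub, MonoidAlgebra.coeff_smul, Finsupp.sub_apply,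
    Finsupp.smul_apply, MonoidAlgebra.coeff_single, Finsupp.single_apply, smul_eq_mul] at hn
  by_cases h : lead lt f = n
  · subst h
    exact absurd (by rw [inv_mul_cancel₀ (coeff_lead_ne_zero hf)]; simp) hn
  · have h0 : f.coeff n ≠ 0 := by
      intro h0
      simp [h0, h] at hn
    exact ((lead_spec (lt := lt) hf).2 n (Finsupp.mem_support_iff.2 h0)).resolve_left (Ne.symm h)

theorem eq_smul_monicize {f : MonoidAlgebra k M} (hf : f ≠ 0) :
    f = f.coeff (lead lt f) • monicize lt f := by
  rw [monicize, smul_smul, mul_inv_cancel₀ (coeff_lead_ne_zero hf), one_smul]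

end LeadingMonomials

-- The diamond lemma for an abstract set of contexts.

section Diamond

variable {k : Type v} [Field k] {M : Type u} [Monoid M]

/-- The linear combinations of the elements `q|_s` with `s ∈ S`, `s ≠ 0`, for which the word
`q|_{lead s}` satisfies `B`. -/
def ctxSpan (ctx : Set (M → M)) (lt : M → M → Prop) (S : Set (MonoidAlgebra k M))
    (B : M → Prop) : Submodule k (MonoidAlgebra k M) :=
  Submodule.span k {g | ∃ q ∈ ctx, ∃ s ∈ S, s ≠ 0 ∧ B (q (lead lt s)) ∧
    g = MonoidAlgebra.mapDomain q s}

theorem isTrivialMod_iff {ctx : Set (M → M)} {lt : M → M → Prop} {S : Set (MonoidAlgebra k M)}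
    {w : M} {f : MonoidAlgebra k M} :
    IsTrivialMod ctx lt S w f ↔ f ∈ ctxSpan ctx lt S (fun m => lt m w) := Iff.rfl

variable {ctx : Set (M → M)} {lt : M → M → Prop} {S : Set (MonoidAlgebra k M)}

theorem ctxSpan_mono {B B' : M → Prop} (h : ∀ m, B m → B' m) :
    ctxSpan ctx lt S B ≤ ctxSpan ctx lt S B' :=
  Submodule.span_mono fun _ ⟨q, hq, s, hs, h0, hB, hg⟩ => ⟨q, hq, s, hs, h0, h _ hB, hg⟩

theorem mapDomain_mem_ctxSpan {B : M → Prop} {q : M → M} (hq : q ∈ ctx) {s : MonoidAlgebra k M}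
    (hs : s ∈ S) (h0 : s ≠ 0) (hB : B (q (lead lt s))) :
    MonoidAlgebra.mapDomain q s ∈ ctxSpan ctx lt S B :=
  Submodule.subset_span ⟨q, hq, s, hs, h0, hB, rfl⟩

theorem mapDomain_monicize_mem_ctxSpan {B : M → Prop} {q : M → M} (hq : q ∈ ctx)
    {s : MonoidAlgebra k M} (hs : s ∈ S) (h0 : s ≠ 0) (hB : B (q (lead lt s))) :
    MonoidAlgebra.mapDomain q (monicize lt s) ∈ ctxSpan ctx lt S B := by
  rw [monicize, ← mapLin_apply, map_smul]
  exact Submodule.smul_mem _ _ (mapDomain_mem_ctxSpan hq hs h0 hB)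

theorem map_mem_ctxSpan {N : Type w} [Monoid N] {ctx' : Set (N → N)} {lt' : N → N → Prop}
    {S' : Set (MonoidAlgebra k N)} {B : M → Prop} {B' : N → Prop} (p : M → N)
    (h : ∀ q ∈ ctx, ∀ s ∈ S, s ≠ 0 → B (q (lead lt s)) →
      MonoidAlgebra.mapDomain p (MonoidAlgebra.mapDomain q s) ∈ ctxSpan ctx' lt' S' B')
    {f : MonoidAlgebra k M} (hf : f ∈ ctxSpan ctx lt S B) :
    MonoidAlgebra.mapDomain p f ∈ ctxSpan ctx' lt' S' B' := by
  have : ctxSpan ctx lt S B ≤ (ctxSpan ctx' lt' S' B').comap (mapLin k p) := by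
    refine Submodule.span_le.2 ?_
    rintro _ ⟨q, hq, s, hs, h0, hB, rfl⟩
    exact h q hq s hs h0 hB
  exact this hf

/-- Contexts preserve triviality. -/
theorem IsTrivialMod.map {w : M} {f : MonoidAlgebra k M} (h : IsTrivialMod ctx lt S w f)
    {p : M → M} (hp : ∀ q ∈ ctx, p ∘ q ∈ ctx) (hlt : ∀ a b, lt a b → lt (p a) (p b)) :
    IsTrivialMod ctx lt S (p w) (MonoidAlgebra.mapDomain p f) := by
  rw [isTrivialMod_iff] at h ⊢
  refine map_mem_ctxSpan p (fun q hq s hs h0 hB => ?_) h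
  rw [mapDomain_mapDomain]
  exact mapDomain_mem_ctxSpan (B := fun m => lt m (p w)) (hp q hq) hs h0 (hlt _ _ hB)

theorem mapDomain_monicize_sub_mem_below (hlt : IsMonomialOrder ctx lt) {q : M → M} (hq : q ∈ ctx)
    {s : MonoidAlgebra k M} (h0 : s ≠ 0) :
    MonoidAlgebra.mapDomain q (monicize lt s) - MonoidAlgebra.single (q (lead lt s)) 1 ∈
      below k lt (q (lead lt s)) := by
  have := hlt.isWellOrder
  have h := map_mem_below (lt' := lt) (fun n hn => hlt.mono q hq n _ hn)
    (monicize_sub_mem_below (lt := lt) h0)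
  rwa [← mapLin_apply, map_sub, mapLin_apply, mapLin_apply, MonoidAlgebra.mapDomain_single] at h

theorem ctxSpan_le_below (hlt : IsMonomialOrder ctx lt) (w : M) :
    ctxSpan ctx lt S (fun m => lt m w) ≤ below k lt w := by
  have := hlt.isWellOrder
  refine Submodule.span_le.2 ?_
  rintro _ ⟨q, hq, s, hs, h0, hB, rfl⟩
  rw [eq_smul_monicize (lt := lt) h0, ← mapLin_apply, map_smul, mapLin_apply]
  refine Submodule.smul_mem _ _ ?_
  have h := (below k lt w).add_mem
    (below_mono hB (mapDomain_monicize_sub_mem_below hlt hq h0)) (single_mem_below hB 1)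
  rwa [sub_add_cancel] at h

/-- If the elements `q|_s` with the same leading word agree modulo smaller ones, then every nonzero
combination of them has a well-defined largest term. -/
theorem exists_leading_term (hlt : IsMonomialOrder ctx lt)
    (hS : ∀ q₁ ∈ ctx, ∀ s₁ ∈ S, s₁ ≠ 0 → ∀ q₂ ∈ ctx, ∀ s₂ ∈ S, s₂ ≠ 0 →
      q₁ (lead lt s₁) = q₂ (lead lt s₂) → IsTrivialMod ctx lt S (q₁ (lead lt s₁))
        (MonoidAlgebra.mapDomain q₁ (monicize lt s₁) -
          MonoidAlgebra.mapDomain q₂ (monicize lt s₂)))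
    {B : M → Prop} {f : MonoidAlgebra k M} (hf : f ∈ ctxSpan ctx lt S B) :
    f = 0 ∨ ∃ q ∈ ctx, ∃ s ∈ S, s ≠ 0 ∧ B (q (lead lt s)) ∧ ∃ a : k,
      IsTrivialMod ctx lt S (q (lead lt s))
        (f - a • MonoidAlgebra.mapDomain q (monicize lt s)) := by
  have := hlt.isWellOrder
  -- A representation whose leading word lies below `w` is itself trivial modulo `w`, so a sum is
  -- governed by its larger leading word.
  have up : ∀ {q : M → M} {s f : MonoidAlgebra k M} {a : k} {w : M}, q ∈ ctx → s ∈ S → s ≠ 0 →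
      lt (q (lead lt s)) w → IsTrivialMod ctx lt S (q (lead lt s))
        (f - a • MonoidAlgebra.mapDomain q (monicize lt s)) → IsTrivialMod ctx lt S w f := by
    intro q s f a w hq hs h0 hw h
    have h1 := ctxSpan_mono (fun m (hm : lt m (q (lead lt s))) => _root_.trans hm hw) h
    have h2 := (ctxSpan ctx lt S (fun m => lt m w)).add_mem h1 (Submodule.smul_mem _ a
      (mapDomain_monicize_mem_ctxSpan (B := fun m => lt m w) hq hs h0 hw))
    rwa [sub_add_cancel] at h2
  refine Submodule.span_induction ?_ (Or.inl rfl) ?_ ?_ hf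
  · rintro _ ⟨q, hq, s, hs, h0, hB, rfl⟩
    refine Or.inr ⟨q, hq, s, hs, h0, hB, s.coeff (lead lt s), ?_⟩
    have : MonoidAlgebra.mapDomain q s =
        s.coeff (lead lt s) • MonoidAlgebra.mapDomain q (monicize lt s) := by
      rw [← mapLin_apply, ← mapLin_apply, ← map_smul, ← eq_smul_monicize h0]
    rw [this, sub_self]
    exact Submodule.zero_mem _
  · rintro f g - - (rfl | ⟨q₁, hq₁, s₁, hs₁, h₁, hB₁, a, ha⟩)
      (rfl | ⟨q₂, hq₂, s₂, hs₂, h₂, hB₂, b, hb⟩)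
    · exact Or.inl (add_zero 0)
    · exact Or.inr ⟨q₂, hq₂, s₂, hs₂, h₂, hB₂, b, by rwa [zero_add]⟩
    · exact Or.inr ⟨q₁, hq₁, s₁, hs₁, h₁, hB₁, a, by rwa [add_zero]⟩
    · right
      rcases trichotomous_of lt (q₁ (lead lt s₁)) (q₂ (lead lt s₂)) with h | h | h
      · refine ⟨q₂, hq₂, s₂, hs₂, h₂, hB₂, b, ?_⟩
        rw [add_sub_assoc]
        exact Submodule.add_mem _ (up hq₁ hs₁ h₁ h ha) hb
      · refine ⟨q₁, hq₁, s₁, hs₁, h₁, hB₁, a + b, ?_⟩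
        -- The leading words coincide: `hS` exchanges the second leading term for the first, and the
        -- coefficients add.
        have h' := Submodule.smul_mem _ b (hS q₁ hq₁ s₁ hs₁ h₁ q₂ hq₂ s₂ hs₂ h₂ h)
        rw [← h] at hb
        have := Submodule.sub_mem _ (Submodule.add_mem _ ha hb) h'
        refine (congrArg (· ∈ _) ?_).mp this
        rw [smul_sub, add_smul]
        abel
      · refine ⟨q₁, hq₁, s₁, hs₁, h₁, hB₁, a, ?_⟩
        rw [add_sub_right_comm]
        exact Submodule.add_mem _ ha (up hq₂ hs₂ h₂ h hb)
  · rintro c f - (rfl | ⟨q, hq, s, hs, h, hB, a, ha⟩)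
    · exact Or.inl (smul_zero c)
    · refine Or.inr ⟨q, hq, s, hs, h, hB, c * a, ?_⟩
      rw [mul_smul, ← smul_sub]
      exact Submodule.smul_mem _ c ha

/-- A combination of elements `q|_s` that involves only irreducible words is zero. -/
theorem eq_zero_of_mem_ctxSpan (hlt : IsMonomialOrder ctx lt)
    (hS : ∀ q₁ ∈ ctx, ∀ s₁ ∈ S, s₁ ≠ 0 → ∀ q₂ ∈ ctx, ∀ s₂ ∈ S, s₂ ≠ 0 →
      q₁ (lead lt s₁) = q₂ (lead lt s₂) → IsTrivialMod ctx lt S (q₁ (lead lt s₁))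
        (MonoidAlgebra.mapDomain q₁ (monicize lt s₁) -
          MonoidAlgebra.mapDomain q₂ (monicize lt s₂)))
    {f : MonoidAlgebra k M} (hirr : ∀ n, f.coeff n ≠ 0 → n ∈ irr ctx lt S)
    (hf : f ∈ ctxSpan ctx lt S (fun _ => True)) : f = 0 := by
  classical
  have := hlt.isWellOrder
  -- The leading word is reducible, hence absent from `f`. Its coefficient in `f` would be `a`, so
  -- `a = 0` and `f` is a combination of strictly smaller terms.
  have step : ∀ B : M → Prop, f ∈ ctxSpan ctx lt S B →
      f = 0 ∨ ∃ w, B w ∧ IsTrivialMod ctx lt S w f := by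
    intro B hB
    refine (exists_leading_term hlt hS hB).imp_right ?_
    rintro ⟨q, hq, s, hs, h0, hw, a, ha⟩
    refine ⟨_, hw, ?_⟩
    have hfw : f.coeff (q (lead lt s)) = 0 := by
      by_contra h
      exact hirr _ h ⟨q, hq, s, hs, h0, rfl⟩
    have h1 := coeff_eq_zero_of_mem_below (ctxSpan_le_below hlt _ ha)
    have h2 := coeff_eq_zero_of_mem_below (mapDomain_monicize_sub_mem_below hlt hq h0)
    have ha0 : a = 0 := by
      simp only [MonoidAlgebra.coeff_sub, MonoidAlgebra.coeff_smul, Finsupp.sub_apply,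
        Finsupp.smul_apply, MonoidAlgebra.coeff_single, Finsupp.single_apply, smul_eq_mul, if_true,
        sub_eq_zero] at h1 h2
      rw [hfw, h2, mul_one] at h1
      exact h1.symm
    rwa [ha0, zero_smul, sub_zero] at ha
  -- Applied with `B` meaning "below `w`", `step` yields an infinite descent unless `f = 0`.
  have key : ∀ w, IsTrivialMod ctx lt S w f → f = 0 := by
    intro w
    induction w using IsWellFounded.induction lt with
    | ind w ih =>
      intro hw
      rcases step _ (isTrivialMod_iff.1 hw) with h | ⟨w', h, h'⟩
      · exact h
      · exact ih w' h h'
  rcases step _ hf with h | ⟨w, -, h⟩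
  · exact h
  · exact key w h

/-- Modulo the elements `q|_s`, every word is a combination of irreducible words. -/
theorem single_mem_span_irr_sup_ctxSpan (hlt : IsMonomialOrder ctx lt) (m : M) :
    (MonoidAlgebra.single m 1 : MonoidAlgebra k M) ∈
      Submodule.span k ((fun n => MonoidAlgebra.single n 1) '' irr ctx lt S) ⊔
        ctxSpan ctx lt S (fun _ => True) := by
  have := hlt.isWellOrder
  induction m using IsWellFounded.induction lt with
  | ind m ih =>
    by_cases hm : m ∈ irr ctx lt S
    · exact Submodule.mem_sup_left (Submodule.subset_span ⟨m, hm, rfl⟩)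
    · obtain ⟨q, hq, s, hs, h0, rfl⟩ := Set.notMem_compl_iff.1 hm
      have h1 := linearMap_mem_of_below LinearMap.id _ ih
        (mapDomain_monicize_sub_mem_below hlt hq h0)
      have h2 : MonoidAlgebra.mapDomain q (monicize lt s) ∈
          Submodule.span k ((fun n => MonoidAlgebra.single n 1) '' irr ctx lt S) ⊔
            ctxSpan ctx lt S (fun _ => True) :=
        Submodule.mem_sup_right (mapDomain_monicize_mem_ctxSpan hq hs h0 trivial)
      have h3 := Submodule.sub_mem _ h2 h1
      rwa [LinearMap.id_apply, sub_sub_cancel] at h3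

end Diamond

-- Overlaps in the free monoid and the basis of irreducible words.

section FreeMonoidDiamond

variable {k : Type v} [Field k]

theorem mapDomain_sandwich {M : Type u} [Monoid M] (a b : M) (f : MonoidAlgebra k M) :
    MonoidAlgebra.mapDomain (fun x => a * x * b) f =
      MonoidAlgebra.single a 1 * f * MonoidAlgebra.single b 1 := by
  have h : mapLin k (fun x => a * x * b) =
      (LinearMap.mulRight k (MonoidAlgebra.single b 1)).comp
        (LinearMap.mulLeft k (MonoidAlgebra.single a (1 : k))) := by
    ext m
    simp [mapLin_apply, MonoidAlgebra.single_mul_single]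
  exact LinearMap.congr_fun h f

/-- Levi's lemma: of two prefixes of a word, one is a prefix of the other. -/
theorem freeMonoid_mul_eq_mul {α : Type*} {a b c d : FreeMonoid α} (h : a * b = c * d) :
    (∃ e, c = a * e ∧ b = e * d) ∨ ∃ e, a = c * e ∧ d = e * b :=
  List.append_eq_append_iff.1 h

variable {Z : Type u}

theorem incl_injective : Function.Injective (incl Z) := by
  intro x y h
  exact List.map_injective_iff.2 (fun _ _ h => BAtom.letter.inj h) h

theorem sandwich_mem_wordCtx (a b : FreeMonoid Z) : (fun x => a * x * b) ∈ wordCtx Z :=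
  ⟨a, b, rfl⟩

theorem sandwich_comp_mem_wordCtx (a b : FreeMonoid Z) {q : FreeMonoid Z → FreeMonoid Z}
    (hq : q ∈ wordCtx Z) : (fun x => a * x * b) ∘ q ∈ wordCtx Z := by
  obtain ⟨c, d, rfl⟩ := hq
  exact ⟨a * c, d * b, by funext x; simp [mul_assoc]⟩

variable [LinearOrder Z]

/-- Inherited from the order on bracketed words, into which deg-lex embeds; well-foundedness below
is obtained in the same way. -/
theorem dlex_mul_mul {x y : FreeMonoid Z} (h : dlex x y) (a b : FreeMonoid Z) :
    dlex (a * x * b) (a * y * b) := by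
  rw [← bracketLT_incl_iff] at h ⊢
  simp only [map_mul]
  exact bracketLT_subst h (.mul (incl Z a) .star (incl Z b))

instance isWellOrder_dlex [WellFoundedLT Z] : IsWellOrder (FreeMonoid Z) dlex where
  wf := Subrelation.wf (fun h => (bracketLT_incl_iff _ _).2 h)
    (InvImage.wf (incl Z) isWellOrder_bracketLT.wf)
  trichotomous x y hxy hyx := by
    rcases listLT_trichotomy (incl Z x).toList (incl Z y).toList with h | h | h
    · exact absurd ((bracketLT_incl_iff _ _).1 h) hxy
    · exact incl_injective (FreeMonoid.toList.injective h)
    · exact absurd ((bracketLT_incl_iff _ _).1 h) hyx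

theorem isMonomialOrder_dlex [WellFoundedLT Z] : IsMonomialOrder (wordCtx Z) (dlex (Z := Z)) where
  isWellOrder := isWellOrder_dlex
  mono := by
    rintro _ ⟨a, b, rfl⟩ x y h
    exact dlex_mul_mul h a b

theorem IsTrivialMod.sandwich {S : Set (MonoidAlgebra k (FreeMonoid Z))} {w : FreeMonoid Z}
    {f : MonoidAlgebra k (FreeMonoid Z)} (h : IsTrivialMod (wordCtx Z) dlex S w f)
    (a b : FreeMonoid Z) : IsTrivialMod (wordCtx Z) dlex S (a * w * b)
      (MonoidAlgebra.single a 1 * f * MonoidAlgebra.single b 1) := by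
  rw [← mapDomain_sandwich]
  exact h.map (p := fun x => a * x * b) (fun q hq => sandwich_comp_mem_wordCtx a b hq)
    (fun x y hxy => dlex_mul_mul hxy a b)

variable {G : Set (MonoidAlgebra k (FreeMonoid Z))}

/-- `a s e h b` is trivial when all monomials of `h` are smaller than the missing leading word. -/
theorem isTrivialMod_mul_below_right {s h : MonoidAlgebra k (FreeMonoid Z)} (hs : s ∈ G)
    (h0 : s ≠ 0) {t : FreeMonoid Z} (ht : h ∈ below k dlex t) (a b : FreeMonoid Z) :
    IsTrivialMod (wordCtx Z) dlex G (a * lead dlex s * t * b)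
      (MonoidAlgebra.single a 1 * monicize dlex s * h * MonoidAlgebra.single b 1) := by
  rw [isTrivialMod_iff]
  refine linearMap_mem_of_below ((LinearMap.mulRight k (MonoidAlgebra.single b 1)).comp
    (LinearMap.mulLeft k (MonoidAlgebra.single a (1 : k) * monicize dlex s))) _ (fun n hn => ?_) ht
  have h1 := mapDomain_monicize_mem_ctxSpan
    (B := fun m => dlex m (a * lead dlex s * t * b)) (sandwich_mem_wordCtx a (n * b)) hs h0 (by
      have := dlex_mul_mul hn (a * lead dlex s) b
      simpa only [mul_assoc] using this)
  rw [mapDomain_sandwich] at h1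
  refine (congrArg (· ∈ _) ?_).mp h1
  simp [mul_assoc, MonoidAlgebra.single_mul_single]

theorem isTrivialMod_mul_below_left {s h : MonoidAlgebra k (FreeMonoid Z)} (hs : s ∈ G)
    (h0 : s ≠ 0) {t : FreeMonoid Z} (ht : h ∈ below k dlex t) (b : FreeMonoid Z) :
    IsTrivialMod (wordCtx Z) dlex G (t * lead dlex s * b)
      (h * monicize dlex s * MonoidAlgebra.single b 1) := by
  rw [isTrivialMod_iff, mul_assoc h]
  refine linearMap_mem_of_below
    (LinearMap.mulRight k (monicize dlex s * MonoidAlgebra.single b 1)) _ (fun n hn => ?_) ht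
  have h1 := mapDomain_monicize_mem_ctxSpan
    (B := fun m => dlex m (t * lead dlex s * b)) (sandwich_mem_wordCtx n b) hs h0 (by
      have := dlex_mul_mul hn 1 (lead dlex s * b)
      simpa only [mul_assoc, one_mul] using this)
  rw [mapDomain_sandwich] at h1
  simpa only [LinearMap.mulRight_apply, mul_assoc] using h1

/-- For monic `s`, `t` with leading words `s'`, `t'`, the difference `s e t' b - s' e t b` equals
`(s - s') e t b - s e (t - t') b`, and both terms involve only words below `s' e t' b`. -/
theorem isTrivialMod_disjoint [WellFoundedLT Z] {s t : MonoidAlgebra k (FreeMonoid Z)}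
    (hs : s ∈ G) (hs0 : s ≠ 0) (ht : t ∈ G) (ht0 : t ≠ 0) (e b : FreeMonoid Z) :
    IsTrivialMod (wordCtx Z) dlex G (lead dlex s * e * lead dlex t * b)
      (monicize dlex s * MonoidAlgebra.single (e * lead dlex t * b) 1 -
        MonoidAlgebra.single (lead dlex s * e) 1 * monicize dlex t * MonoidAlgebra.single b 1) := by
  have h1 : MonoidAlgebra.single e 1 * (monicize dlex t - MonoidAlgebra.single (lead dlex t) 1)
      * MonoidAlgebra.single b 1 ∈ below k dlex (e * lead dlex t * b) := by
    rw [← mapDomain_sandwich]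
    exact map_mem_below (fun n hn => dlex_mul_mul hn e b) (monicize_sub_mem_below ht0)
  have h2 : (monicize dlex s - MonoidAlgebra.single (lead dlex s) 1) * MonoidAlgebra.single e 1 ∈
      below k dlex (lead dlex s * e) := by
    have := map_mem_below (k := k) (q := fun x => 1 * x * e) (lt' := dlex)
      (fun n hn => dlex_mul_mul hn 1 e) (monicize_sub_mem_below hs0)
    rwa [mapDomain_sandwich, ← MonoidAlgebra.one_def, one_mul, one_mul] at this
  have h3 := isTrivialMod_mul_below_right hs hs0 h1 1 1
  have h4 := isTrivialMod_mul_below_left ht ht0 h2 b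
  simp only [← MonoidAlgebra.one_def, one_mul, mul_one, ← mul_assoc] at h3
  refine (congrArg (· ∈ _) ?_).mp (Submodule.sub_mem _ h4 h3)
  have e1 : (MonoidAlgebra.single (e * lead dlex t * b) 1 : MonoidAlgebra k (FreeMonoid Z)) =
      MonoidAlgebra.single e 1 * MonoidAlgebra.single (lead dlex t) 1 *
        MonoidAlgebra.single b 1 := by
    simp [MonoidAlgebra.single_mul_single]
  have e2 : (MonoidAlgebra.single (lead dlex s * e) 1 : MonoidAlgebra k (FreeMonoid Z)) =
      MonoidAlgebra.single (lead dlex s) 1 * MonoidAlgebra.single e 1 := by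
    simp [MonoidAlgebra.single_mul_single]
  rw [e1, e2]
  noncomm_ring

/-- Levi's lemma, used twice, sorts the positions: disjoint, one word inside the other, or a proper
overlap. The definition of an intersection composition demands strict length inequalities, so
degenerate overlaps are first reduced to the inclusion or disjoint case. -/
theorem isTrivialMod_of_overlap_right [WellFoundedLT Z]
    (hG : IsGSBasis (wordCtx Z) FreeMonoid.length dlex G)
    {s t : MonoidAlgebra k (FreeMonoid Z)}
    (hs : s ∈ G) (hs0 : s ≠ 0) (ht : t ∈ G) (ht0 : t ≠ 0) {b d b' : FreeMonoid Z}
    (h : lead dlex s * b = d * (lead dlex t * b')) :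
    IsTrivialMod (wordCtx Z) dlex G (lead dlex s * b)
      (monicize dlex s * MonoidAlgebra.single b 1 -
        MonoidAlgebra.single d 1 * monicize dlex t * MonoidAlgebra.single b' 1) := by
  rcases freeMonoid_mul_eq_mul h with ⟨e, rfl, rfl⟩ | ⟨e, hde, heb⟩
  · have := isTrivialMod_disjoint hs hs0 ht ht0 e b'
    simpa only [mul_assoc] using this
  rcases freeMonoid_mul_eq_mul heb with ⟨c, hc, rfl⟩ | ⟨c, hc, rfl⟩
  · -- the leading word of `t` ends inside the leading word of `s`
    have h1 := (hG s hs hs0 t ht ht0).2 _ _ (sandwich_mem_wordCtx d c) rfl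
      (by rw [hde, hc, mul_assoc])
    have h2 := h1.sandwich 1 b
    rw [mapDomain_sandwich, ← MonoidAlgebra.one_def, one_mul, one_mul, sub_mul, mul_assoc,
      mul_assoc, MonoidAlgebra.single_mul_single, one_mul] at h2
    rwa [mul_assoc]
  -- Here the leading words are `d e` and `e c`. If `d = 1` the first is a prefix of the second, so
  -- the inclusion composition occurs with the roles exchanged, hence with a sign.
  · by_cases hd : d = 1
    · subst hd
      have h1 := (hG t ht ht0 s hs hs0).2 _ _ (sandwich_mem_wordCtx 1 c) rfl
        (by rw [hc, hde, one_mul, one_mul])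
      have h2 := Submodule.neg_mem _ (h1.sandwich 1 b')
      rw [mapDomain_sandwich, ← MonoidAlgebra.one_def, one_mul, one_mul, sub_mul, neg_sub, one_mul,
        mul_assoc, MonoidAlgebra.single_mul_single, one_mul] at h2
      rw [← MonoidAlgebra.one_def, one_mul]
      rw [show lead dlex s * (c * b') = lead dlex t * b' by rw [hc, hde, one_mul, mul_assoc]]
      exact h2
    by_cases hc1 : c = 1
    · subst hc1
      have h1 := (hG s hs hs0 t ht ht0).2 _ _ (sandwich_mem_wordCtx d 1) rfl
        (by rw [hde, hc, mul_one, mul_one])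
      have h2 := h1.sandwich 1 b'
      rw [mapDomain_sandwich, ← MonoidAlgebra.one_def, one_mul, one_mul, sub_mul, mul_one] at h2
      rwa [one_mul]
    -- The words are merely adjacent, which is the disjoint case with empty gap.
    by_cases he : e = 1
    · subst he
      have h1 := isTrivialMod_disjoint hs hs0 ht ht0 1 b'
      rw [mul_one] at hde
      rw [one_mul] at hc
      rw [hde, ← hc] at *
      simpa only [mul_one, one_mul, mul_assoc] using h1
    have pos : ∀ x : FreeMonoid Z, x ≠ 1 → 0 < x.length := fun x hx =>
      Nat.pos_of_ne_zero fun h => hx (FreeMonoid.length_eq_zero.1 h)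
    have hd' := pos d hd
    have hc' := pos c hc1
    have he' := pos e he
    have h1 := (hG s hs hs0 t ht ht0).1 (lead dlex s * c) c d rfl
      (by rw [hc, hde, mul_assoc])
      (by rw [hc, hde]; simp only [FreeMonoid.length_mul]; omega)
      (by rw [hc, hde]; simp only [FreeMonoid.length_mul]; omega)
    have h2 := h1.sandwich 1 b'
    rw [← MonoidAlgebra.one_def, one_mul, one_mul, sub_mul, mul_assoc, mul_assoc,
      MonoidAlgebra.single_mul_single, one_mul] at h2
    exact h2

/-- All ways of reducing a word agree modulo smaller words. -/
theorem isTrivialMod_of_overlap [WellFoundedLT Z]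
    (hG : IsGSBasis (wordCtx Z) FreeMonoid.length dlex G)
    {q₁ q₂ : FreeMonoid Z → FreeMonoid Z} {s t : MonoidAlgebra k (FreeMonoid Z)}
    (hq₁ : q₁ ∈ wordCtx Z) (hs : s ∈ G) (hs0 : s ≠ 0)
    (hq₂ : q₂ ∈ wordCtx Z) (ht : t ∈ G) (ht0 : t ≠ 0)
    (h : q₁ (lead dlex s) = q₂ (lead dlex t)) :
    IsTrivialMod (wordCtx Z) dlex G (q₁ (lead dlex s))
      (MonoidAlgebra.mapDomain q₁ (monicize dlex s) -
        MonoidAlgebra.mapDomain q₂ (monicize dlex t)) := by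
  -- The case where the first occurrence starts no later than the second; the other case follows by
  -- symmetry and a sign.
  have key : ∀ (a b a' b' e : FreeMonoid Z) (s t : MonoidAlgebra k (FreeMonoid Z)), s ∈ G →
      s ≠ 0 → t ∈ G → t ≠ 0 → a' = a * e → lead dlex s * b = e * (lead dlex t * b') →
      IsTrivialMod (wordCtx Z) dlex G (a * lead dlex s * b)
        (MonoidAlgebra.mapDomain (fun x => a * x * b) (monicize dlex s) -
          MonoidAlgebra.mapDomain (fun x => a' * x * b') (monicize dlex t)) := by
    rintro a b _ b' e s t hs hs0 ht ht0 rfl h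
    have h1 := (isTrivialMod_of_overlap_right hG hs hs0 ht ht0 h).sandwich a 1
    rw [mul_one, ← MonoidAlgebra.one_def, mul_one, mul_sub, ← mul_assoc] at h1
    rw [mapDomain_sandwich, mapDomain_sandwich]
    have e1 : (MonoidAlgebra.single (a * e) 1 : MonoidAlgebra k (FreeMonoid Z)) =
        MonoidAlgebra.single a 1 * MonoidAlgebra.single e 1 := by
      simp [MonoidAlgebra.single_mul_single]
    rw [e1]
    simpa only [mul_assoc] using h1
  obtain ⟨a, b, rfl⟩ := hq₁
  obtain ⟨a', b', rfl⟩ := hq₂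
  have h' := h
  simp only [mul_assoc] at h'
  rcases freeMonoid_mul_eq_mul h' with ⟨e, ha, hb⟩ | ⟨e, ha, hb⟩
  · exact key a b a' b' e s t hs hs0 ht ht0 ha hb
  · have h1 := Submodule.neg_mem _ (key a' b' a b e t s ht ht0 hs hs0 ha hb)
    rw [neg_sub] at h1
    rw [h]
    exact h1

/-- The ideal is additively generated by the products `a g b`; expanding `a` and `b` into monomials
leaves terms `q|_g`. -/
theorem mem_ctxSpan_of_mem_span {f : MonoidAlgebra k (FreeMonoid Z)}
    (hf : f ∈ TwoSidedIdeal.span G) : f ∈ ctxSpan (wordCtx Z) dlex G (fun _ => True) := by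
  rw [TwoSidedIdeal.mem_span_iff_mem_addSubgroup_closure] at hf
  refine (AddSubgroup.closure_le (ctxSpan (wordCtx Z) dlex G fun _ => True).toAddSubgroup).2 ?_ hf
  rintro _ ⟨_, ⟨a, -, g, hg, rfl⟩, b, -, rfl⟩
  by_cases h0 : g = 0
  · subst h0
    simp
  change (LinearMap.mulRight k b) (a * g) ∈ ctxSpan (wordCtx Z) dlex G fun _ => True
  refine linearMap_mem_of_single_mem (LinearMap.mulLeft k (a * g)) _ fun n _ => ?_
  rw [LinearMap.mulLeft_apply, mul_assoc]
  refine linearMap_mem_of_single_mem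
    (LinearMap.mulRight k (g * MonoidAlgebra.single n 1)) _ fun m _ => ?_
  rw [LinearMap.mulRight_apply, ← mul_assoc, ← mapDomain_sandwich]
  exact mapDomain_mem_ctxSpan (sandwich_mem_wordCtx m n) hg h0 trivial

theorem mem_span_of_mem_ctxSpan {f : MonoidAlgebra k (FreeMonoid Z)} {B : FreeMonoid Z → Prop}
    (hf : f ∈ ctxSpan (wordCtx Z) dlex G B) : f ∈ TwoSidedIdeal.span G := by
  refine Submodule.span_induction ?_ (zero_mem _) (fun _ _ _ _ => add_mem) ?_ hf
  · rintro _ ⟨_, ⟨a, b, rfl⟩, s, hs, -, -, rfl⟩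
    rw [mapDomain_sandwich]
    exact TwoSidedIdeal.mul_mem_right _ _ _
      (TwoSidedIdeal.mul_mem_left _ _ _ (TwoSidedIdeal.subset_span hs))
  · intro c f _ h
    rw [← one_mul f, ← smul_mul_assoc]
    exact TwoSidedIdeal.mul_mem_left _ _ _ h

/-- The classes of the irreducible words form a basis of the quotient. -/
def irrBasis [WellFoundedLT Z] (hG : IsGSBasis (wordCtx Z) FreeMonoid.length dlex G) :
    Module.Basis (irr (wordCtx Z) dlex G) k (TwoSidedIdeal.span G).ringCon.Quotient :=
  Module.Basis.mk
    (v := fun m => RingCon.mkₐ k (TwoSidedIdeal.span G).ringCon (MonoidAlgebra.single m.1 1))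
    (by
      rw [linearIndependent_iff]
      intro l hl
      let f : MonoidAlgebra k (FreeMonoid Z) := MonoidAlgebra.ofCoeff (l.mapDomain Subtype.val)
      have hf : f = l.sum fun m a => a • MonoidAlgebra.single m.1 1 := by
        simp [f, Finsupp.mapDomain, MonoidAlgebra.ofCoeff_finsuppSum]
      have hmem : f ∈ TwoSidedIdeal.span G := by
        have h1 : RingCon.mkₐ k (TwoSidedIdeal.span G).ringCon f = 0 := by
          rw [hf, map_finsuppSum, ← hl, Finsupp.linearCombination_apply]
          simp only [map_smul]
        exact (TwoSidedIdeal.mem_iff _ _).2 (Quotient.exact h1)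
      -- A linear relation among the classes is an element of the ideal supported on irreducible
      -- words, hence zero.
      have h0 := eq_zero_of_mem_ctxSpan isMonomialOrder_dlex
        (fun q₁ h₁ s₁ hs₁ h₁' q₂ h₂ s₂ hs₂ h₂' h =>
          isTrivialMod_of_overlap hG h₁ hs₁ h₁' h₂ hs₂ h₂' h)
        (f := f) (by
          intro n hn
          by_contra h
          exact hn (Finsupp.mapDomain_of_notMem_range _ _ (by simpa using h)))
        (mem_ctxSpan_of_mem_span hmem)
      exact Finsupp.mapDomain_injective Subtype.val_injective
        ((congrArg MonoidAlgebra.coeff h0).trans Finsupp.mapDomain_zero.symm))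
    (by
      rintro x -
      obtain ⟨f, rfl⟩ : ∃ f, RingCon.mkₐ k (TwoSidedIdeal.span G).ringCon f = x :=
        Quotient.exists_rep x
      refine linearMap_mem_of_single_mem
        (RingCon.mkₐ k (TwoSidedIdeal.span G).ringCon).toLinearMap _ fun m _ => ?_
      have h1 := single_mem_span_irr_sup_ctxSpan (S := G) (isMonomialOrder_dlex (Z := Z)) m
      obtain ⟨y, hy, z, hz, hyz⟩ := Submodule.mem_sup.1 h1
      have hz0 : RingCon.mkₐ k (TwoSidedIdeal.span G).ringCon z = 0 :=
        Quotient.sound ((TwoSidedIdeal.mem_iff _ _).1 (mem_span_of_mem_ctxSpan hz))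
      rw [← hyz, AlgHom.toLinearMap_apply, map_add, hz0, add_zero]
      refine (Submodule.span_le (p := (Submodule.span k _).comap
        (RingCon.mkₐ k (TwoSidedIdeal.span G).ringCon).toLinearMap)).2 ?_ hy
      rintro _ ⟨n, hn, rfl⟩
      exact Submodule.subset_span ⟨⟨n, hn⟩, rfl⟩)

theorem irrBasis_apply [WellFoundedLT Z] (hG : IsGSBasis (wordCtx Z) FreeMonoid.length dlex G)
    (m : irr (wordCtx Z) dlex G) : irrBasis hG m =
      RingCon.mkₐ k (TwoSidedIdeal.span G).ringCon (MonoidAlgebra.single m.1 1) := by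
  rw [irrBasis, Module.Basis.mk_apply]

end FreeMonoidDiamond

-- Contexts whose value is an ordinary word or a single bracket.

section StarWords

variable {Z : Type u}

theorem length_bracket (x : BWord Z) : FreeMonoid.length (bracket x) = 1 := rfl

theorem length_incl (x : FreeMonoid Z) : FreeMonoid.length (incl Z x) = x.length :=
  List.length_map _

theorem bracket_injective : Function.Injective (bracket (Z := Z)) := by
  intro x y h
  exact FreeMonoid.toList.injective (BAtom.bracket.inj (FreeMonoid.of_injective h))

theorem bracket_ne_incl (x : BWord Z) (y : FreeMonoid Z) : bracket x ≠ incl Z y := by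
  intro h
  have h' : [BAtom.bracket x.toList] = y.toList.map BAtom.letter := h
  have h1 : BAtom.bracket x.toList ∈ y.toList.map BAtom.letter := by
    rw [← h']
    exact List.mem_singleton_self _
  obtain ⟨z, -, hz⟩ := List.mem_map.1 h1
  exact BAtom.noConfusion rfl (heq_of_eq hz)

theorem bracket_ne_self (x : BWord Z) : bracket x ≠ x := by
  intro h
  have h' : [BAtom.bracket x.toList] = x.toList := h
  have := congrArg sizeOf h'
  simp at this
  omega

theorem mul_eq_incl {a b : BWord Z} {x : FreeMonoid Z} (h : a * b = incl Z x) :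
    ∃ a' b', a = incl Z a' ∧ b = incl Z b' := by
  obtain ⟨l₁, l₂, -, h1, h2⟩ := List.map_eq_append_iff.1 h.symm
  exact ⟨FreeMonoid.ofList l₁, FreeMonoid.ofList l₂, h1.symm, h2.symm⟩

/-- The `⋆` cannot sit under a bracket, since the bracket would survive substitution; what surrounds
it is then a pair of ordinary words. -/
theorem subst_eq_incl {q : StarWord Z} {y : BWord Z} {x : FreeMonoid Z}
    (h : q.subst y = incl Z x) :
    ∃ a b : FreeMonoid Z, q.subst = fun z => incl Z a * z * incl Z b := by
  induction q generalizing x with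
  | star => exact ⟨1, 1, by funext z; simp [StarWord.subst]⟩
  | mul a q b ih =>
    obtain ⟨c, b', hc, rfl⟩ := mul_eq_incl h
    obtain ⟨a', d, rfl, hd⟩ := mul_eq_incl hc
    obtain ⟨a₁, b₁, h₁⟩ := ih hd
    exact ⟨a' * a₁, b₁ * b', by funext z; simp [StarWord.subst, h₁, mul_assoc]⟩
  | bracket q ih => exact absurd h (bracket_ne_incl _ _)

theorem subst_bracket_ne_incl (q : StarWord Z) (x : BWord Z) (y : FreeMonoid Z) :
    q.subst (bracket x) ≠ incl Z y := by
  intro h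
  obtain ⟨a, b, hq⟩ := subst_eq_incl h
  rw [hq] at h
  obtain ⟨c, -, hc, -⟩ := mul_eq_incl h
  obtain ⟨-, d, -, hd⟩ := mul_eq_incl hc
  exact bracket_ne_incl _ _ hd

theorem eq_one_of_subst_eq_one {q : StarWord Z} {x : BWord Z} (h : q.subst x = 1) : x = 1 := by
  induction q with
  | star => exact h
  | mul a q b ih =>
    refine ih (FreeMonoid.length_eq_zero.1 ?_)
    have := FreeMonoid.length_eq_zero.2 h
    simp only [StarWord.subst, FreeMonoid.length_mul] at this
    omega
  | bracket q ih =>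
    exact absurd (FreeMonoid.length_eq_zero.2 h) (by simp [StarWord.subst, length_bracket])

/-- A bracket has breadth one, so a nonempty `x` leaves no room for side factors. The case `x = 1`
is a genuine exception: in `⌊u⌋ ⋆` the symbol simply disappears. -/
theorem subst_eq_bracket {q : StarWord Z} {x u : BWord Z} (h : q.subst x = bracket u) :
    x = 1 ∨ q.subst = id ∨ ∃ q' : StarWord Z, q.subst = bracket ∘ q'.subst := by
  induction q with
  | star => exact Or.inr (Or.inl rfl)
  | mul a q b ih =>
    have hl := congrArg FreeMonoid.length h
    simp only [StarWord.subst, FreeMonoid.length_mul, length_bracket] at hl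
    by_cases h0 : (q.subst x).length = 0
    · exact Or.inl (eq_one_of_subst_eq_one (FreeMonoid.length_eq_zero.1 h0))
    · obtain rfl : a = 1 := FreeMonoid.length_eq_zero.1 (by omega)
      obtain rfl : b = 1 := FreeMonoid.length_eq_zero.1 (by omega)
      have hq : (StarWord.mul 1 q 1).subst = q.subst := by
        funext z
        simp [StarWord.subst]
      rw [hq] at h ⊢
      exact ih h
  | bracket q ih => exact Or.inr (Or.inr ⟨q, rfl⟩)

theorem mem_range_incl_iff (m : BWord Z) :
    m ∈ Set.range (incl Z) ↔ ¬ ∃ q ∈ starCtx Z, ∃ x : BWord Z, m = q (bracket x) := by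
  constructor
  · rintro ⟨y, rfl⟩ ⟨_, ⟨q, rfl⟩, x, h⟩
    exact subst_bracket_ne_incl q x y h.symm
  · intro h
    induction m using FreeMonoid.inductionOn' with
    | one => exact ⟨1, map_one _⟩
    | of_mul a m ih =>
      cases a with
      | bracket x =>
        exact absurd ⟨_, ⟨.mul 1 .star m, rfl⟩, FreeMonoid.ofList x, by
          simp [StarWord.subst, bracket]⟩ h
      | letter z =>
        obtain ⟨y, rfl⟩ := ih fun ⟨_, ⟨q, rfl⟩, x, hx⟩ =>
          h ⟨_, ⟨.mul (FreeMonoid.of (.letter z)) q 1, rfl⟩, x, by simp [StarWord.subst, hx]⟩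
        exact ⟨FreeMonoid.of z * y, by simp [incl]⟩

theorem sandwich_mem_starCtx (a b : BWord Z) : (fun x => a * x * b) ∈ starCtx Z :=
  ⟨.mul a .star b, rfl⟩

end StarWords

-- The identity `⌊z⌋ - c z` and its leading words.

section ScalarOPI

variable {k : Type v} [Field k]

theorem evalOPI_scalarOPI (c : k) {B : Type w} [Ring B] [Algebra k B] (P : B →ₗ[k] B)
    (θ : Unit → B) : evalOPI P θ (scalarOPI c) = P (θ ()) - c • θ () := by
  simp [evalOPI, scalarOPI, evalWord, bracket, evalAtom, evalList, MonoidAlgebra.lift_single]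

theorem isOPIAlgebra_scalarOPI_iff (c : k) {B : Type w} [Ring B] [Algebra k B] (P : B →ₗ[k] B) :
    IsOPIAlgebra (scalarOPI c) P ↔ ∀ r, P r = c • r := by
  simp only [IsOPIAlgebra, evalOPI_scalarOPI, sub_eq_zero]
  exact ⟨fun h r => h fun _ => r, fun h θ => h _⟩

variable {Z : Type u}

/-- The linear map `f ↦ ⌊f⌋ - c f`. -/
def bracketSub (c : k) (Z : Type u) :
    MonoidAlgebra k (BWord Z) →ₗ[k] MonoidAlgebra k (BWord Z) :=
  bracketOp k Z - c • LinearMap.id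

theorem bracketOp_single (x : BWord Z) (a : k) :
    bracketOp k Z (MonoidAlgebra.single x a) = MonoidAlgebra.single (bracket x) a :=
  MonoidAlgebra.mapDomain_single

theorem wordInstances_scalarOPI (c : k) :
    wordInstances (scalarOPI c) Z =
      Set.range fun x : BWord Z => bracketSub c Z (MonoidAlgebra.single x 1) := by
  ext f
  simp only [wordInstances, evalOPI_scalarOPI, Set.mem_ofPred_eq, Set.mem_range]
  exact ⟨fun ⟨θ, h⟩ => ⟨θ (), h.symm⟩, fun ⟨x, h⟩ => ⟨fun _ => x, h.symm⟩⟩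

variable {lt : BWord Z → BWord Z → Prop}

/-- If `⌊x⌋ < x`, iterating the bracket gives an infinite descending chain. This fixes the leading
words of `S_φ(Z)` for every monomial order. -/
theorem lt_bracket (hlt : IsMonomialOrder (starCtx Z) lt) (x : BWord Z) : lt x (bracket x) := by
  have := hlt.isWellOrder
  have h : ¬ lt (bracket x) x := by
    induction x using IsWellFounded.induction lt with
    | ind x ih =>
      intro h
      exact ih _ h (hlt.mono _ ⟨.bracket .star, rfl⟩ _ _ h)
  rcases trichotomous_of lt x (bracket x) with h' | h' | h'
  · exact h'
  · exact absurd h'.symm (bracket_ne_self x)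
  · exact absurd h' h

theorem coeff_bracketSub_single (c : k) (x : BWord Z) :
    (bracketSub c Z (MonoidAlgebra.single x 1)).coeff (bracket x) = 1 := by
  classical
  simp [bracketSub, bracketOp_single, (bracket_ne_self x).symm]

theorem bracketSub_single_ne_zero (c : k) (x : BWord Z) :
    bracketSub c Z (MonoidAlgebra.single x 1) ≠ 0 := by
  intro h
  have h1 := coeff_bracketSub_single c x
  rw [h] at h1
  exact zero_ne_one h1

theorem lead_bracketSub_single (hlt : IsMonomialOrder (starCtx Z) lt) (c : k) (x : BWord Z) :
    lead lt (bracketSub c Z (MonoidAlgebra.single x 1)) = bracket x := by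
  classical
  have := hlt.isWellOrder
  refine lead_eq (by rw [coeff_bracketSub_single]; exact one_ne_zero) fun n hn => ?_
  by_contra! h
  have hx : x ≠ n := fun h' => h.2 (h' ▸ lt_bracket hlt x)
  exact hn (by simp [bracketSub, bracketOp_single, Ne.symm h.1, hx])

theorem monicize_bracketSub_single (hlt : IsMonomialOrder (starCtx Z) lt) (c : k) (x : BWord Z) :
    monicize lt (bracketSub c Z (MonoidAlgebra.single x 1)) =
      bracketSub c Z (MonoidAlgebra.single x 1) := by
  rw [monicize, lead_bracketSub_single hlt, coeff_bracketSub_single, inv_one, one_smul]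

end ScalarOPI

-- Transfer from ordinary to bracketed words.

section Inclusion

variable {k : Type v} [Field k] {Z : Type u}

theorem inclAlg_apply (f : MonoidAlgebra k (FreeMonoid Z)) :
    inclAlg k Z f = MonoidAlgebra.mapDomain (incl Z) f := rfl

theorem inclAlg_single (x : FreeMonoid Z) (a : k) :
    inclAlg k Z (MonoidAlgebra.single x a) = MonoidAlgebra.single (incl Z x) a :=
  MonoidAlgebra.mapDomain_single

theorem inclAlg_injective : Function.Injective (inclAlg k Z) :=
  MonoidAlgebra.mapDomain_injective incl_injective

theorem inclAlg_ne_zero {f : MonoidAlgebra k (FreeMonoid Z)} (hf : f ≠ 0) : inclAlg k Z f ≠ 0 :=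
  (map_ne_zero_iff _ inclAlg_injective).2 hf

theorem coeff_inclAlg (f : MonoidAlgebra k (FreeMonoid Z)) (x : FreeMonoid Z) :
    (inclAlg k Z f).coeff (incl Z x) = f.coeff x :=
  Finsupp.mapDomain_apply incl_injective _ _

theorem inclAlg_mapDomain_sandwich (a b : FreeMonoid Z) (f : MonoidAlgebra k (FreeMonoid Z)) :
    inclAlg k Z (MonoidAlgebra.mapDomain (fun x => a * x * b) f) =
      MonoidAlgebra.mapDomain (fun x => incl Z a * x * incl Z b) (inclAlg k Z f) := by
  rw [mapDomain_sandwich, mapDomain_sandwich, map_mul, map_mul, inclAlg_single, inclAlg_single]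

variable [LinearOrder Z] [WellFoundedLT Z] {lt : BWord Z → BWord Z → Prop}

theorem lead_inclAlg (hlt : IsMonomialOrder (starCtx Z) lt)
    (hd : ∀ x y : FreeMonoid Z, lt (incl Z x) (incl Z y) ↔ dlex x y)
    {f : MonoidAlgebra k (FreeMonoid Z)} (hf : f ≠ 0) :
    lead lt (inclAlg k Z f) = incl Z (lead dlex f) := by
  have := hlt.isWellOrder
  refine lead_eq (by rw [coeff_inclAlg]; exact coeff_lead_ne_zero hf) fun n hn => ?_
  obtain ⟨x, rfl⟩ : n ∈ Set.range (incl Z) := by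
    by_contra h
    exact hn (Finsupp.mapDomain_of_notMem_range _ _ h)
  rw [coeff_inclAlg] at hn
  rw [hd, incl_injective.eq_iff]
  exact (lead_spec hf).2 x (Finsupp.mem_support_iff.2 hn)

theorem monicize_inclAlg (hlt : IsMonomialOrder (starCtx Z) lt)
    (hd : ∀ x y : FreeMonoid Z, lt (incl Z x) (incl Z y) ↔ dlex x y)
    {f : MonoidAlgebra k (FreeMonoid Z)} (hf : f ≠ 0) :
    monicize lt (inclAlg k Z f) = inclAlg k Z (monicize dlex f) := by
  rw [monicize, monicize, lead_inclAlg hlt hd hf, coeff_inclAlg, map_smul]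

/-- Contexts and leading words are preserved by the inclusion, so each trivializing combination is
carried over term by term. -/
theorem IsTrivialMod.inclAlg (hlt : IsMonomialOrder (starCtx Z) lt)
    (hd : ∀ x y : FreeMonoid Z, lt (incl Z x) (incl Z y) ↔ dlex x y)
    {G : Set (MonoidAlgebra k (FreeMonoid Z))} {S : Set (MonoidAlgebra k (BWord Z))}
    (hS : inclAlg k Z '' G ⊆ S) {w : FreeMonoid Z} {f : MonoidAlgebra k (FreeMonoid Z)}
    (h : IsTrivialMod (wordCtx Z) dlex G w f) :
    IsTrivialMod (starCtx Z) lt S (incl Z w) (inclAlg k Z f) := by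
  rw [isTrivialMod_iff] at h ⊢
  refine map_mem_ctxSpan (incl Z) ?_ h
  rintro _ ⟨a, b, rfl⟩ s hs h0 hB
  rw [← inclAlg_apply, inclAlg_mapDomain_sandwich]
  refine mapDomain_mem_ctxSpan (B := fun m => lt m (incl Z w))
    (sandwich_mem_starCtx _ _) (hS ⟨s, hs, rfl⟩) (inclAlg_ne_zero h0) ?_
  rw [lead_inclAlg hlt hd h0, ← map_mul, ← map_mul, hd]
  exact hB

end Inclusion

-- Compositions and irreducible words of `S_φ(Z) ∪ G`.

section OperatedGS

variable {k : Type v} [Field k] {Z : Type u} {lt : BWord Z → BWord Z → Prop}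

/-- If the leading word of an element of `S` is `1`, everything smaller than `w` is trivial. -/
theorem isTrivialMod_of_lead_eq_one (hlt : IsMonomialOrder (starCtx Z) lt)
    {S : Set (MonoidAlgebra k (BWord Z))} {g : MonoidAlgebra k (BWord Z)} (hg : g ∈ S)
    (hg0 : g ≠ 0) (h1 : lead lt g = 1) {w : BWord Z} {f : MonoidAlgebra k (BWord Z)}
    (hf : f ∈ below k lt w) : IsTrivialMod (starCtx Z) lt S w f := by
  have := hlt.isWellOrder
  rw [isTrivialMod_iff]
  refine linearMap_mem_of_below LinearMap.id _ (fun m hm => ?_) hf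
  induction m using IsWellFounded.induction lt with
  | ind m ih =>
    -- Since `lead g = 1`, the word `m` is the leading word of `m g`; the other terms of `m g` are
    -- below `m` and covered by induction.
    have hq := sandwich_mem_starCtx m 1
    have e : m * lead lt g * 1 = m := by rw [h1, mul_one, mul_one]
    have h2 := mapDomain_monicize_sub_mem_below hlt hq hg0
    simp only [e] at h2
    have h3 := linearMap_mem_of_below LinearMap.id _
      (fun n hn => ih n hn (_root_.trans hn hm)) h2
    have h4 := mapDomain_monicize_mem_ctxSpan (B := fun m => lt m w) hq hg hg0 (by rwa [e])
    have h5 := Submodule.sub_mem _ h4 h3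
    rwa [LinearMap.id_apply, sub_sub_cancel] at h5

/-- The inclusion compositions of `⌊x⌋ - c x` with the elements of a set containing `S_φ(Z)`. -/
theorem isTrivialMod_inclusion_bracketSub (hlt : IsMonomialOrder (starCtx Z) lt) (c : k)
    {S : Set (MonoidAlgebra k (BWord Z))} (hS : wordInstances (scalarOPI c) Z ⊆ S)
    {g : MonoidAlgebra k (BWord Z)} (hg : g ∈ S) (hg0 : g ≠ 0)
    (hid : ∀ x, lead lt g = bracket x → g = bracketSub c Z (MonoidAlgebra.single x 1))
    {x : BWord Z} {q : BWord Z → BWord Z} (hq : q ∈ starCtx Z) (h : bracket x = q (lead lt g)) :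
    IsTrivialMod (starCtx Z) lt S (bracket x)
      (bracketSub c Z (MonoidAlgebra.single x 1) -
        MonoidAlgebra.mapDomain q (monicize lt g)) := by
  have := hlt.isWellOrder
  obtain ⟨q, rfl⟩ := hq
  rcases subst_eq_bracket h.symm with h1 | h1 | ⟨q', h1⟩
  -- Both monic terms have leading word `⌊x⌋`, so their difference lies below it, and `lead g = 1`
  -- makes that trivial.
  · refine isTrivialMod_of_lead_eq_one hlt hg hg0 h1 ?_
    have h2 := monicize_sub_mem_below (lt := lt) (bracketSub_single_ne_zero c x)
    rw [lead_bracketSub_single hlt, monicize_bracketSub_single hlt] at h2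
    have h3 := mapDomain_monicize_sub_mem_below hlt ⟨q, rfl⟩ hg0
    rw [← h] at h3
    have h4 := Submodule.sub_mem _ h2 h3
    rwa [sub_sub_sub_cancel_right] at h4
  · rw [h1] at h ⊢
    have h2 := hid x h.symm
    have h3 : MonoidAlgebra.mapDomain id (monicize lt g) = monicize lt g := by
      ext
      simp
    rw [h3, h2, monicize_bracketSub_single hlt, sub_self]
    exact Submodule.zero_mem _
  · rw [h1] at h ⊢
    have hx : x = q'.subst (lead lt g) := bracket_injective h
    have h2 : MonoidAlgebra.mapDomain q'.subst (monicize lt g) - MonoidAlgebra.single x 1 ∈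
        below k lt x := by
      rw [hx]
      exact mapDomain_monicize_sub_mem_below hlt ⟨q', rfl⟩ hg0
    -- With `h = q'|_g - x` supported below `x`, the element `⌊h⌋ - c h` is a combination of
    -- instances `⌊n⌋ - c n` with `⌊n⌋ < ⌊x⌋`.
    have h3 : bracketSub c Z (MonoidAlgebra.mapDomain q'.subst (monicize lt g) -
        MonoidAlgebra.single x 1) ∈ ctxSpan (starCtx Z) lt S (fun m => lt m (bracket x)) := by
      refine linearMap_mem_of_below _ _ (fun n hn => ?_) h2
      have h5 := mapDomain_mem_ctxSpan (B := fun m => lt m (bracket x)) (lt := lt)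
        (sandwich_mem_starCtx (1 : BWord Z) 1)
        (hS (wordInstances_scalarOPI c ▸ Set.mem_range_self n)) (bracketSub_single_ne_zero c n)
        (by
          rw [lead_bracketSub_single hlt, one_mul, mul_one]
          exact hlt.mono _ ⟨.bracket .star, rfl⟩ _ _ hn)
      rwa [mapDomain_sandwich, ← MonoidAlgebra.one_def, one_mul, mul_one] at h5
    -- The remaining term `c q'|_g` has context word `x`, which is below `⌊x⌋`.
    have h4 := mapDomain_monicize_mem_ctxSpan (B := fun m => lt m (bracket x)) (lt := lt)
      (Set.mem_range_self q' : q'.subst ∈ starCtx Z) hg hg0 (by rw [← hx]; exact lt_bracket hlt x)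
    refine (congrArg (· ∈ _) ?_).mp
      (Submodule.sub_mem _ (Submodule.neg_mem _ h3) (Submodule.smul_mem _ c h4))
    have h6 : MonoidAlgebra.mapDomain (bracket ∘ q'.subst) (monicize lt g) =
        bracketOp k Z (MonoidAlgebra.mapDomain q'.subst (monicize lt g)) :=
      (mapDomain_mapDomain _ _ _).symm
    rw [h6, map_sub, bracketSub]
    simp only [LinearMap.sub_apply, LinearMap.smul_apply, LinearMap.id_apply]
    abel

theorem reducible_union (hlt : IsMonomialOrder (starCtx Z) lt) (c : k)
    (T : Set (MonoidAlgebra k (BWord Z))) :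
    reducible (starCtx Z) lt (wordInstances (scalarOPI c) Z ∪ T) =
      reducible (starCtx Z) lt T ∪ {m | ∃ q ∈ starCtx Z, ∃ x : BWord Z, m = q (bracket x)} := by
  ext m
  constructor
  · rintro ⟨q, hq, s, hs | hs, h0, rfl⟩
    · rw [wordInstances_scalarOPI] at hs
      obtain ⟨x, rfl⟩ := hs
      exact Or.inr ⟨q, hq, x, by rw [lead_bracketSub_single hlt]⟩
    · exact Or.inl ⟨q, hq, s, hs, h0, rfl⟩
  · rintro (⟨q, hq, s, hs, h0, rfl⟩ | ⟨q, hq, x, rfl⟩)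
    · exact ⟨q, hq, s, Or.inr hs, h0, rfl⟩
    · exact ⟨q, hq, _, Or.inl (wordInstances_scalarOPI c ▸ Set.mem_range_self x),
        bracketSub_single_ne_zero c x, by rw [lead_bracketSub_single hlt]⟩

theorem irr_union (hlt : IsMonomialOrder (starCtx Z) lt) (c : k)
    (T : Set (MonoidAlgebra k (BWord Z))) :
    irr (starCtx Z) lt (wordInstances (scalarOPI c) Z ∪ T) =
      Set.range (incl Z) \ reducible (starCtx Z) lt T := by
  rw [irr, reducible_union hlt, Set.compl_union, Set.inter_comm]
  congr 1
  ext m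
  exact (mem_range_incl_iff m).symm

variable [LinearOrder Z] [WellFoundedLT Z]

theorem isGSBasis_union (hlt : IsMonomialOrder (starCtx Z) lt)
    (hd : ∀ x y : FreeMonoid Z, lt (incl Z x) (incl Z y) ↔ dlex x y) (c : k)
    {G : Set (MonoidAlgebra k (FreeMonoid Z))}
    (hG : IsGSBasis (wordCtx Z) FreeMonoid.length dlex G) :
    IsGSBasis (starCtx Z) FreeMonoid.length lt
      (wordInstances (scalarOPI c) Z ∪ inclAlg k Z '' G) := by
  have := hlt.isWellOrder
  intro f hf hf0 g hg hg0
  have hid : ∀ x, lead lt g = bracket x → g = bracketSub c Z (MonoidAlgebra.single x 1) := by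
    intro x hx
    rcases hg with hg | ⟨g, hg, rfl⟩
    · rw [wordInstances_scalarOPI] at hg
      obtain ⟨y, rfl⟩ := hg
      dsimp only at hx ⊢
      rw [lead_bracketSub_single hlt] at hx
      rw [bracket_injective hx]
    · rw [lead_inclAlg hlt hd ((map_ne_zero_iff _ inclAlg_injective).1 hg0)] at hx
      exact absurd hx.symm (bracket_ne_incl _ _)
  rcases hf with hf | ⟨f, hf, rfl⟩
  · rw [wordInstances_scalarOPI] at hf
    obtain ⟨x, rfl⟩ := hf
    dsimp only
    rw [lead_bracketSub_single hlt, monicize_bracketSub_single hlt]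
    -- With one leading word of breadth 1 and the other of breadth `n`, an overlap would need
    -- breadth strictly between `max 1 n` and `1 + n`.
    refine ⟨fun w u v _ _ h1 h2 => ?_, ?_⟩
    · rw [length_bracket] at h1 h2
      omega
    · rintro _ q hq rfl h
      exact isTrivialMod_inclusion_bracketSub hlt c Set.subset_union_left hg hg0 hid hq h
  have hf0' : f ≠ 0 := (map_ne_zero_iff _ inclAlg_injective).1 hf0
  rw [lead_inclAlg hlt hd hf0', monicize_inclAlg hlt hd hf0']
  rcases hg with hg | ⟨g, hg, rfl⟩
  · rw [wordInstances_scalarOPI] at hg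
    obtain ⟨y, rfl⟩ := hg
    dsimp only
    rw [lead_bracketSub_single hlt]
    refine ⟨fun w u v _ _ h1 h2 => ?_, ?_⟩
    · rw [length_bracket] at h1 h2
      omega
    · rintro _ _ ⟨q, rfl⟩ rfl h
      exact absurd h.symm (subst_bracket_ne_incl _ _ _)
  have hg0' : g ≠ 0 := (map_ne_zero_iff _ inclAlg_injective).1 hg0
  rw [lead_inclAlg hlt hd hg0', monicize_inclAlg hlt hd hg0']
  constructor
  · rintro _ u v rfl h h1 h2
    -- A proper overlap makes `u` and `v` factors of the ordinary leading words, hence ordinary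
    -- themselves; a disjoint position contradicts the length bound.
    rcases freeMonoid_mul_eq_mul h with ⟨e, rfl, rfl⟩ | ⟨e, he, he'⟩
    · simp only [FreeMonoid.length_mul] at h2
      omega
    · obtain ⟨v, -, rfl, -⟩ := mul_eq_incl he.symm
      obtain ⟨-, u, -, rfl⟩ := mul_eq_incl he'.symm
      rw [← map_mul, ← map_mul] at h
      rw [← map_mul, length_incl, length_incl, length_incl] at h1 h2
      have h3 := ((hG f hf hf0' g hg hg0').1 _ u v rfl (incl_injective h) h1 h2).inclAlg hlt hd
        (S := wordInstances (scalarOPI c) Z ∪ inclAlg k Z '' G) Set.subset_union_right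
      rwa [map_mul, map_sub, map_mul, map_mul, inclAlg_single, inclAlg_single] at h3
  · rintro _ _ ⟨q, rfl⟩ rfl h
    obtain ⟨a, b, hq⟩ := subst_eq_incl h.symm
    rw [hq] at h ⊢
    dsimp only at h
    rw [← map_mul, ← map_mul] at h
    have h3 := ((hG f hf hf0' g hg hg0').2 _ _ (sandwich_mem_wordCtx a b) rfl
      (incl_injective h)).inclAlg hlt hd
        (S := wordInstances (scalarOPI c) Z ∪ inclAlg k Z '' G) Set.subset_union_right
    rwa [map_sub, inclAlg_mapDomain_sandwich] at h3

theorem incl_mem_reducible_iff (hlt : IsMonomialOrder (starCtx Z) lt)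
    (hd : ∀ x y : FreeMonoid Z, lt (incl Z x) (incl Z y) ↔ dlex x y)
    (G : Set (MonoidAlgebra k (FreeMonoid Z))) (x : FreeMonoid Z) :
    incl Z x ∈ reducible (starCtx Z) lt (inclAlg k Z '' G) ↔ x ∈ reducible (wordCtx Z) dlex G := by
  constructor
  · rintro ⟨_, ⟨q, rfl⟩, _, ⟨s, hs, rfl⟩, h0, h⟩
    have h0' : s ≠ 0 := (map_ne_zero_iff _ inclAlg_injective).1 h0
    obtain ⟨a, b, hq⟩ := subst_eq_incl h.symm
    rw [hq, lead_inclAlg hlt hd h0'] at h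
    dsimp only at h
    rw [← map_mul, ← map_mul] at h
    exact ⟨_, sandwich_mem_wordCtx a b, s, hs, h0', incl_injective h⟩
  · rintro ⟨_, ⟨a, b, rfl⟩, s, hs, h0, rfl⟩
    refine ⟨_, sandwich_mem_starCtx (incl Z a) (incl Z b), _, ⟨s, hs, rfl⟩, inclAlg_ne_zero h0, ?_⟩
    rw [lead_inclAlg hlt hd h0, map_mul, map_mul]

theorem irr_union_inclAlg (hlt : IsMonomialOrder (starCtx Z) lt)
    (hd : ∀ x y : FreeMonoid Z, lt (incl Z x) (incl Z y) ↔ dlex x y) (c : k)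
    (G : Set (MonoidAlgebra k (FreeMonoid Z))) :
    irr (starCtx Z) lt (wordInstances (scalarOPI c) Z ∪ inclAlg k Z '' G) =
      incl Z '' irr (wordCtx Z) dlex G := by
  rw [irr_union hlt]
  ext m
  constructor
  · rintro ⟨⟨x, rfl⟩, h⟩
    exact ⟨x, fun h' => h ((incl_mem_reducible_iff hlt hd G x).2 h'), rfl⟩
  · rintro ⟨x, h, rfl⟩
    exact ⟨⟨x, rfl⟩, fun h' => h ((incl_mem_reducible_iff hlt hd G x).1 h')⟩

end OperatedGS

-- The quotient as `A` with the operator `c`, its freeness and its basis.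

section Quotient

variable {k : Type v} [Field k] {Z : Type u}

theorem operatedIdeal_le {S : Set (MonoidAlgebra k (BWord Z))}
    {J : TwoSidedIdeal (MonoidAlgebra k (BWord Z))}
    (hS : S ⊆ (J : Set (MonoidAlgebra k (BWord Z)))) (hJ : ∀ f ∈ J, bracketOp k Z f ∈ J) :
    operatedIdeal S ≤ J :=
  sInf_le ⟨hS, hJ⟩

theorem operatedIdeal_union_span (c : k) (G : Set (MonoidAlgebra k (FreeMonoid Z))) :
    operatedIdeal (wordInstances (scalarOPI c) Z ∪ inclAlg k Z '' G) =
      operatedIdeal (relations c (TwoSidedIdeal.span G)) := by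
  apply le_antisymm
  · refine operatedIdeal_le ?_ (bracketOp_mem_operatedIdeal _)
    rintro f (hf | ⟨g, hg, rfl⟩)
    · exact subset_operatedIdeal _ _ (Or.inl hf)
    · exact subset_operatedIdeal _ _ (Or.inr ⟨g, TwoSidedIdeal.subset_span hg, rfl⟩)
  · refine operatedIdeal_le ?_ (bracketOp_mem_operatedIdeal _)
    rintro f (hf | ⟨g, hg, rfl⟩)
    · exact subset_operatedIdeal _ _ (Or.inl hf)
    -- The preimage of the operated ideal in `k 𝓜(Z)` is a two-sided ideal containing `G`.
    · have h : TwoSidedIdeal.span G ≤ TwoSidedIdeal.comap (inclAlg k Z)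
          (operatedIdeal (wordInstances (scalarOPI c) Z ∪ inclAlg k Z '' G)) := by
        rw [TwoSidedIdeal.span_le]
        intro f hf
        exact (TwoSidedIdeal.mem_comap _).2 (subset_operatedIdeal _ _ (Or.inr ⟨f, hf, rfl⟩))
      exact (TwoSidedIdeal.mem_comap _).1 (h hg)

variable (c : k) (I : TwoSidedIdeal (MonoidAlgebra k (FreeMonoid Z)))

/-- The map from `k 𝓜(Z) / I` to the free `φ`-algebra over it. -/
abbrev relIncl : I.ringCon.Quotient →ₐ[k] OpQuot (relations c I) :=
  quotIncl I (relations c I) (fun f hf => Or.inr ⟨f, hf, rfl⟩)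

theorem relIncl_mk (f : MonoidAlgebra k (FreeMonoid Z)) :
    relIncl c I (RingCon.mkₐ k I.ringCon f) = opMk (relations c I) (inclAlg k Z f) := rfl

theorem quotOp_opMk (S : Set (MonoidAlgebra k (BWord Z))) (f : MonoidAlgebra k (BWord Z)) :
    quotOp S (opMk S f) = opMk S (bracketOp k Z f) := rfl

/-- `S_φ(Z)` imposes the identity on words only; it extends to all elements because `f ↦ ⌊f⌋ - c f`
is linear. -/
theorem quotOp_relations (r : OpQuot (relations c I)) :
    quotOp (relations c I) r = c • r := by
  obtain ⟨f, rfl⟩ := RingCon.mkₐ_surjective (α := k) (operatedIdeal (relations c I)).ringCon r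
  change quotOp _ (opMk (relations c I) f) = c • opMk (relations c I) f
  rw [quotOp_opMk, ← map_smul, ← sub_eq_zero, ← map_sub]
  change (opMk (relations c I)).toLinearMap (bracketSub c Z f) = 0
  rw [← LinearMap.comp_apply, ← Submodule.mem_bot (R := k)]
  refine linearMap_mem_of_single_mem _ _ fun n _ => ?_
  rw [Submodule.mem_bot]
  refine Quotient.sound ((TwoSidedIdeal.mem_iff _ _).1 (subset_operatedIdeal _ _ (Or.inl ?_)))
  rw [wordInstances_scalarOPI]
  exact Set.mem_range_self n

mutual
-- Structural recursion: in the quotient a bracket is `c` times the class of its contents, so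
-- brackets disappear from the inside out.
theorem single_atom_mem_range : ∀ a : BAtom Z,
    opMk (relations c I) (MonoidAlgebra.single (FreeMonoid.of a) 1) ∈ (relIncl c I).range
  | .letter z => ⟨RingCon.mkₐ k I.ringCon (MonoidAlgebra.single (FreeMonoid.of z) 1), by
      change relIncl c I (RingCon.mkₐ k I.ringCon _) = _
      rw [relIncl_mk, inclAlg_single]
      rfl⟩
  | .bracket x => by
    have h : (MonoidAlgebra.single (FreeMonoid.of (BAtom.bracket x)) 1 :
        MonoidAlgebra k (BWord Z)) =
        bracketOp k Z (MonoidAlgebra.single (FreeMonoid.ofList x) 1) := by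
      rw [bracketOp_single]
      rfl
    rw [h, ← quotOp_opMk, quotOp_relations]
    exact Subalgebra.smul_mem _ (single_word_mem_range x) c
theorem single_word_mem_range : ∀ x : List (BAtom Z),
    opMk (relations c I) (MonoidAlgebra.single (FreeMonoid.ofList x) 1) ∈ (relIncl c I).range
  | [] => by
    rw [FreeMonoid.ofList_nil, ← MonoidAlgebra.one_def, map_one]
    exact one_mem _
  | a :: x => by
    have h : (MonoidAlgebra.single (FreeMonoid.ofList (a :: x)) 1 : MonoidAlgebra k (BWord Z)) =
        MonoidAlgebra.single (FreeMonoid.of a) 1 *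
          MonoidAlgebra.single (FreeMonoid.ofList x) 1 := by
      rw [MonoidAlgebra.single_mul_single, one_mul]
      rfl
    rw [h, map_mul]
    exact mul_mem (single_atom_mem_range a) (single_word_mem_range x)
end

theorem relIncl_surjective : Function.Surjective (relIncl c I) := by
  intro r
  obtain ⟨f, rfl⟩ := RingCon.mkₐ_surjective (α := k) (operatedIdeal (relations c I)).ringCon r
  exact linearMap_mem_of_single_mem (opMk (relations c I)).toLinearMap
    (Subalgebra.toSubmodule (relIncl c I).range) fun n _ => single_word_mem_range c I n.toList

/-- Evaluation in `k 𝓜(Z) / I` with the operator `c`. -/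
def scalarEval : MonoidAlgebra k (BWord Z) →ₐ[k] I.ringCon.Quotient :=
  evalOPI (c • LinearMap.id)
    (fun z => RingCon.mkₐ k I.ringCon (MonoidAlgebra.single (FreeMonoid.of z) 1))

theorem scalarEval_inclAlg (f : MonoidAlgebra k (FreeMonoid Z)) :
    scalarEval c I (inclAlg k Z f) = RingCon.mkₐ k I.ringCon f := by
  have h : (scalarEval c I).comp (inclAlg k Z) = RingCon.mkₐ k I.ringCon := by
    apply MonoidAlgebra.algHom_ext' _ (Subsingleton.elim _ _)
    apply FreeMonoid.hom_eq
    intro z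
    simp [scalarEval, inclAlg, evalOPI, evalWord, incl, evalAtom, MonoidAlgebra.lift_single]
  exact AlgHom.congr_fun h f

/-- Evaluation respects the operators, and the target carries multiplication by `c`; it suffices to
see this on words. -/
theorem scalarEval_bracketOp (f : MonoidAlgebra k (BWord Z)) :
    scalarEval c I (bracketOp k Z f) = c • scalarEval c I f := by
  have h : (scalarEval c I).toLinearMap (bracketSub c Z f) ∈
      (⊥ : Submodule k I.ringCon.Quotient) := by
    rw [← LinearMap.comp_apply]
    refine linearMap_mem_of_single_mem _ _ fun n _ => ?_
    have hl : ∀ l : List (BAtom Z), ∀ (P : I.ringCon.Quotient → I.ringCon.Quotient)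
        (θ : Z → I.ringCon.Quotient),
        evalList P θ l = evalWord P θ (FreeMonoid.ofList l) := by
      intro l P θ
      induction l with
      | nil => simp [evalList]
      | cons a l ih => rw [FreeMonoid.ofList_cons, map_mul, evalList, ih]; simp [evalWord]
    have hb : ∀ (P : I.ringCon.Quotient → I.ringCon.Quotient) (θ : Z → I.ringCon.Quotient),
        evalWord P θ (bracket n) = P (evalWord P θ n) := by
      intro P θ
      rw [← FreeMonoid.ofList_toList n, ← hl]
      simp [evalWord, bracket, evalAtom]
    simp [bracketSub, bracketOp_single, scalarEval, evalOPI, MonoidAlgebra.lift_single, hb]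
  rw [Submodule.mem_bot, AlgHom.toLinearMap_apply, bracketSub, LinearMap.sub_apply,
    LinearMap.smul_apply, LinearMap.id_apply, map_sub, map_smul, sub_eq_zero] at h
  exact h

theorem operatedIdeal_relations_le_ker :
    operatedIdeal (relations c I) ≤ TwoSidedIdeal.ker (scalarEval c I) := by
  refine operatedIdeal_le ?_ fun f hf => ?_
  · rintro f (hf | ⟨g, hg, rfl⟩)
    · rw [wordInstances_scalarOPI] at hf
      obtain ⟨x, rfl⟩ := hf
      change bracketSub c Z _ ∈ TwoSidedIdeal.ker _
      rw [TwoSidedIdeal.mem_ker, bracketSub, LinearMap.sub_apply, map_sub, scalarEval_bracketOp,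
        LinearMap.smul_apply, map_smul, LinearMap.id_apply, sub_self]
    · change _ ∈ TwoSidedIdeal.ker _
      rw [TwoSidedIdeal.mem_ker, scalarEval_inclAlg]
      exact Quotient.sound ((TwoSidedIdeal.mem_iff _ _).1 hg)
  · rw [TwoSidedIdeal.mem_ker] at hf ⊢
    rw [scalarEval_bracketOp, hf, smul_zero]

/-- The inverse of `relIncl`. -/
def relRetract : OpQuot (relations c I) →ₐ[k] I.ringCon.Quotient :=
  RingCon.liftₐ _ (scalarEval c I) (by
    intro f g h
    have h1 : f - g ∈ operatedIdeal (relations c I) := (TwoSidedIdeal.rel_iff _ f g).1 h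
    have h2 := (TwoSidedIdeal.mem_ker _).1 (operatedIdeal_relations_le_ker c I h1)
    rw [map_sub, sub_eq_zero] at h2
    exact h2)

theorem relRetract_relIncl (a : I.ringCon.Quotient) : relRetract c I (relIncl c I a) = a := by
  obtain ⟨f, rfl⟩ := RingCon.mkₐ_surjective (α := k) I.ringCon a
  exact scalarEval_inclAlg c I f

theorem relIncl_bijective : Function.Bijective (relIncl c I) :=
  ⟨Function.LeftInverse.injective (relRetract_relIncl c I), relIncl_surjective c I⟩

/-- All operators involved are multiplication by `c`, so every algebra morphism is operated.
Extending along the bijection `relIncl` is then composition with its inverse. -/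
theorem isFreeOPIAlgebraOver_relations :
    IsFreeOPIAlgebraOver.{max u v, max u v, 0, v, w} (scalarOPI c) (quotOp (relations c I))
      (relIncl c I) := by
  refine ⟨(isOPIAlgebra_scalarOPI_iff c _).2 (quotOp_relations c I), ?_⟩
  intro C _ _ P' hP' f
  rw [isOPIAlgebra_scalarOPI_iff] at hP'
  refine ⟨f.comp (relRetract c I), ⟨fun b => ?_, ?_⟩, ?_⟩
  · rw [quotOp_relations, map_smul, hP']
  · refine AlgHom.ext fun a => ?_
    exact congrArg f (relRetract_relIncl c I a)
  · rintro F ⟨-, rfl⟩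
    refine AlgHom.ext fun b => ?_
    obtain ⟨a, rfl⟩ := relIncl_surjective c I b
    exact congrArg F (congrArg (relIncl c I) (relRetract_relIncl c I a).symm)

/-- `relIncl` as a linear equivalence. -/
def relEquiv : I.ringCon.Quotient ≃ₗ[k] OpQuot (relations c I) :=
  LinearEquiv.ofBijective (relIncl c I).toLinearMap (relIncl_bijective c I)

theorem relEquiv_mk_single (x : FreeMonoid Z) :
    relEquiv c I (RingCon.mkₐ k I.ringCon (MonoidAlgebra.single x 1)) =
      opMk (relations c I) (MonoidAlgebra.single (incl Z x) 1) := by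
  rw [← inclAlg_single]
  rfl

theorem exists_basis_irr [LinearOrder Z] [WellFoundedLT Z] {lt : BWord Z → BWord Z → Prop}
    (hlt : IsMonomialOrder (starCtx Z) lt)
    (hd : ∀ x y : FreeMonoid Z, lt (incl Z x) (incl Z y) ↔ dlex x y)
    {G : Set (MonoidAlgebra k (FreeMonoid Z))}
    (hG : IsGSBasis (wordCtx Z) FreeMonoid.length dlex G) :
    ∃ b : Module.Basis
        (irr (starCtx Z) lt (wordInstances (scalarOPI c) Z ∪ inclAlg k Z '' G)) k
        (OpQuot (relations c (TwoSidedIdeal.span G))),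
      ∀ m, b m = opMk (relations c (TwoSidedIdeal.span G))
        (MonoidAlgebra.single (m : BWord Z) 1) := by
  let e : irr (wordCtx Z) dlex G ≃
      irr (starCtx Z) lt (wordInstances (scalarOPI c) Z ∪ inclAlg k Z '' G) :=
    (Equiv.Set.image (incl Z) _ incl_injective).trans
      (Equiv.setCongr (irr_union_inclAlg hlt hd c G).symm)
  have he : ∀ x, (e x : BWord Z) = incl Z x := fun _ => rfl
  clear_value e
  refine ⟨((irrBasis hG).map (relEquiv c (TwoSidedIdeal.span G))).reindex e, fun m => ?_⟩
  obtain ⟨x, rfl⟩ := e.surjective m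
  rw [Module.Basis.reindex_apply, Equiv.symm_apply_apply, Module.Basis.map_apply, irrBasis_apply,
    relEquiv_mk_single, he]

end Quotient

end OpGS

end

open OpGS in
theorem mainTheorem8 {k : Type v} [Field k] {Z : Type u} [LinearOrder Z] [WellFoundedLT Z]
    (c : k) (I : TwoSidedIdeal (MonoidAlgebra k (FreeMonoid Z)))
    (G : Set (MonoidAlgebra k (FreeMonoid Z))) (hI : TwoSidedIdeal.span G = I)
    (hG : IsGSBasis (wordCtx Z) FreeMonoid.length dlex G) :
    -- the explicit order is a monomial order on `𝔐(Z)` that restricts to the deg-lex order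
    (IsMonomialOrder (starCtx Z) (bracketLT (Z := Z)) ∧
      ∀ x y : FreeMonoid Z, bracketLT (incl Z x) (incl Z y) ↔ dlex x y) ∧
    -- and for every such order:
    ∀ lt : BWord Z → BWord Z → Prop, IsMonomialOrder (starCtx Z) lt →
      (∀ x y : FreeMonoid Z, lt (incl Z x) (incl Z y) ↔ dlex x y) →
      -- `S_φ(Z) ∪ G` is an operated Gröbner–Shirshov basis
      IsGSBasis (starCtx Z) FreeMonoid.length lt
        (wordInstances (scalarOPI c) Z ∪ inclAlg k Z '' G) ∧
      -- of the operated ideal generated by `S_φ(Z) ∪ I`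
      operatedIdeal (wordInstances (scalarOPI c) Z ∪ inclAlg k Z '' G) =
        operatedIdeal (relations c I) ∧
      -- the three descriptions of the irreducible words
      irr (starCtx Z) lt (wordInstances (scalarOPI c) Z ∪ inclAlg k Z '' G) =
        (reducible (starCtx Z) lt (inclAlg k Z '' G) ∪
          {m | ∃ q ∈ starCtx Z, ∃ x : BWord Z, m = q (bracket x)})ᶜ ∧
      irr (starCtx Z) lt (wordInstances (scalarOPI c) Z ∪ inclAlg k Z '' G) =
        Set.range (incl Z) \ reducible (starCtx Z) lt (inclAlg k Z '' G) ∧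
      irr (starCtx Z) lt (wordInstances (scalarOPI c) Z ∪ inclAlg k Z '' G) =
        incl Z '' irr (wordCtx Z) dlex G ∧
      -- the quotient is the free `φ`-algebra over `A = k 𝓜(Z) / I`
      IsFreeOPIAlgebraOver.{max u v, max u v, 0, v, w} (scalarOPI c)
        (quotOp (relations c I))
        (quotIncl I (relations c I) (fun f hf => Or.inr ⟨f, hf, rfl⟩)) ∧
      -- and the classes of the irreducible words form a linear basis of it
      ∃ b : Module.Basis
          (irr (starCtx Z) lt (wordInstances (scalarOPI c) Z ∪ inclAlg k Z '' G)) k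
          (OpQuot (relations c I)),
        ∀ m, b m = opMk (relations c I) (MonoidAlgebra.single (m : BWord Z) 1) := by
  subst hI
  refine ⟨⟨isMonomialOrder_bracketLT, bracketLT_incl_iff⟩, fun lt hlt hd => ?_⟩
  refine ⟨isGSBasis_union hlt hd c hG, operatedIdeal_union_span c G, ?_, irr_union hlt c _,
    irr_union_inclAlg hlt hd c G, isFreeOPIAlgebraOver_relations c _, exists_basis_irr c hlt hd hG⟩
  rw [irr, reducible_union hlt]
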